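/- Let $\mathbb T=\mathbb R^2/\mathbb Z^2$ and let $S$ be the set of positive integers that are sums of two integer squares. For $n\in S$ put $\Lambda_n=\{\lambda\in\mathbb Z^2:|\lambda|^2=n\}$, $\mathcal N_n=|\Lambda_n|$ and $r_n(x)=\mathcal N_n^{-1}\sum_{\lambda\in\Lambda_n}\cos(2\pi\langle\lambda,x\rangle)$. Let $(a_\lambda)_{\lambda\in\mathbb Z^2\setminus\{0\}}$ be standard complex Gaussian random variables (real and imaginary parts independent, centered, of variance $1/2$) on a probability space $(\Omega,\mathcal F,\mathbb P)$, independent except for the relations $\overline{a_\lambda}=a_{-\lambda}$, and let $$T_n(x)=\mathcal N_n^{-1/2}\sum_{\lambda\in\Lambda_n}a_\lambda e^{2\pi i\langle\lambda,x\rangle},\qquad x\in\mathbb T,$$ be the arithmetic random wave, a real Gaussian field with covariance $\mathbb E[T_n(x)T_n(y)]=r_n(x-y)$. Let $$\mathcal Z_n=\lim_{\varepsilon\to0^+}\frac1{2\varepsilon}\,\mathrm{meas}\{x\in\mathbb T:|T_n(x)|<\varepsilon\}$$ (limit in probability) be the Leray measure of its zero set. Let $\mathbf A$ be the closure in $L^2(\mathbb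 P)$ of the real linear span of the variables $z a_\lambda+\overline z a_{-\lambda}$ ($\lambda\neq0$, $z\in\mathbb C$). For $q\ge0$ let $C_q$, the $q$-th Wiener chaos, be the closure in $L^2(\mathbb P)$ of the real linear span of the products $H_{p_1}(\xi_1)\cdots H_{p_k}(\xi_k)$ with $k\ge1$, $p_1+\dots+p_k=q$ and $(\xi_1,\dots,\xi_k)$ a standard Gaussian vector with entries in $\mathbf A$, where $H_p$ is the $p$-th (probabilists') Hermite polynomial, and let $\mathcal Z_n[q]$ be the orthogonal projection of $\mathcal Z_n$ onto $C_q$. Then for every $n\in S$ the limit $\mathcal Z_n$ exists and lies in $L^2(\mathbb P)$, and $$\mathrm{Var}(\mathcal Z_n[2])=\frac1{4\pi\mathcal N_n}.$$ For every $K\ge2$ there is a constant $c_K$, depending only on $K$, such that for all $n\in S$ $$\sum_{q\ge K}\mathrm{Var}(\mathcal Z_n[2q])\le c_K\int_{\mathbb T}r_n(x)^{2K}\,dx .$$ In particular there is an absolute constant $c$ such that $\sum_{q\ge2}\mathrm{Var}(\mathcal Z_n[2q])\le c\,\mathcal N_n^{-2}$ for all $n\in S$. Consequently, with an absolute implied constant,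 for all $n\in S$, $$\mathrm{Var}(\mathcal Z_n)=\frac1{4\pi\mathcal N_n}+O\left(\frac1{\mathcal N_n^2}\right).$$ -/

import Mathlib

open MeasureTheory ProbabilityTheory Filter Topology
open scoped ENNReal NNReal ComplexConjugate

noncomputable section

namespace ArithmeticWave

/-- The flat torus `ℝ² / ℤ²`, with its Lebesgue measure `volume` of total mass one. -/
abbrev Torus : Type := UnitAddTorus (Fin 2)

/-- The set of integers that are sums of two integer squares (all of them are nonnegative). -/
def sumsOfTwoSquares : Set ℕ := {n | ∃ a b : ℤ, (n : ℤ) = a ^ 2 + b ^ 2}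

/-- The lattice points on the circle of radius `√n` centred at the origin. -/
def latticePoints (n : ℕ) : Finset (Fin 2 → ℤ) :=
  (Fintype.piFinset fun _ => Finset.Icc (-(n : ℤ)) n).filter fun l => l 0 ^ 2 + l 1 ^ 2 = n

/-- The box in the definition of `latticePoints` loses nothing. -/
theorem mem_latticePoints (n : ℕ) (l : Fin 2 → ℤ) :
    l ∈ latticePoints n ↔ l 0 ^ 2 + l 1 ^ 2 = n := by
  simp only [latticePoints, Finset.mem_filter, Fintype.mem_piFinset, Finset.mem_Icc,
    and_iff_right_iff_imp, Fin.forall_fin_two]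
  intro h
  refine ⟨⟨?_, ?_⟩, ?_, ?_⟩ <;>
    nlinarith [sq_nonneg (l 0), sq_nonneg (l 1), Int.le_self_sq (l 0), Int.le_self_sq (l 1),
      Int.le_self_sq (-(l 0)), Int.le_self_sq (-(l 1))]

/-- The number of lattice points on the circle of radius `√n`, which is the dimension of the
eigenspace of the Laplacian for the eigenvalue `4π²n`. -/
def latticeCount (n : ℕ) : ℕ := (latticePoints n).card

/-- The covariance function `x ↦ N⁻¹ ∑ cos (2π⟨l, x⟩)` of the arithmetic random wave, the sum
being over the lattice points `l` of norm `√n`; here `UnitAddTorus.mFourier l x` is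
`exp (2πi⟨l, x⟩)`. -/
def waveCov (n : ℕ) (x : Torus) : ℝ :=
  (latticeCount n : ℝ)⁻¹ * ∑ l ∈ latticePoints n, (UnitAddTorus.mFourier l x).re

/-- A set containing exactly one of `l`, `-l` for every nonzero lattice point `l`. -/
def halfLattice : Set (Fin 2 → ℤ) := {l | 0 < l 1 ∨ (l 1 = 0 ∧ 0 < l 0)}

variable {Ω : Type*}

/-- The arithmetic random wave `T_n(x) = N^{-1/2} ∑ a_l exp (2πi⟨l, x⟩)`. The sum is almost surely
real, because `conj (a_l) = a_{-l}`; `re` only serves to get a value in `ℝ`. -/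
def wave (a : (Fin 2 → ℤ) → Ω → ℂ) (n : ℕ) (x : Torus) (ω : Ω) : ℝ :=
  (((Real.sqrt (latticeCount n) : ℂ))⁻¹ *
    ∑ l ∈ latticePoints n, a l ω * UnitAddTorus.mFourier l x).re

/-- The approximation `(2ε)⁻¹ meas {x : |T_n(x)| < ε}` of the Leray measure. -/
def lerayApprox (a : (Fin 2 → ℤ) → Ω → ℂ) (n : ℕ) (ε : ℝ) (ω : Ω) : ℝ :=
  (2 * ε)⁻¹ * (volume : Measure Torus).real {x | |wave a n x ω| < ε}

variable [MeasurableSpace Ω]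

/-- A family of standard complex Gaussian random variables `a l`, `l ≠ 0`, that are independent
except for the relations `conj (a l) = a (-l)`. Nothing is required of `a 0`, which is not used. -/
structure IsGaussianCoefficients (a : (Fin 2 → ℤ) → Ω → ℂ) (P : Measure Ω) : Prop where
  measurable : ∀ l, l ≠ 0 → Measurable (a l)
  hasLaw_re : ∀ l, l ≠ 0 → HasLaw (fun ω => (a l ω).re) (gaussianReal 0 (1 / 2)) P
  hasLaw_im : ∀ l, l ≠ 0 → HasLaw (fun ω => (a l ω).im) (gaussianReal 0 (1 / 2)) P
  indep_re_im : ∀ l, l ≠ 0 → IndepFun (fun ω => (a l ω).re) (fun ω => (a l ω).im) P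
  iIndep : iIndepFun (fun l : halfLattice => a l) P
  conj_eq : ∀ l, l ≠ 0 → ∀ᵐ ω ∂P, conj (a l ω) = a (-l) ω

/-- `Z` is the Leray (microcanonical) measure of the nodal set of `T_n`: the limit in probability
of `(2ε)⁻¹ meas {x : |T_n(x)| < ε}` as `ε → 0+`. -/
def IsLerayMeasure (a : (Fin 2 → ℤ) → Ω → ℂ) (P : Measure Ω) (n : ℕ) (Z : Ω → ℝ) : Prop :=
  TendstoInMeasure P (lerayApprox a n) (𝓝[>] 0) Z

/-- The real Gaussian Hilbert space generated by the coefficients: the closure in `L²(P)` of the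
real linear combinations of the variables `z * a_l + conj z * a_{-l}`, `l ≠ 0`, `z ∈ ℂ`. -/
def gaussianSpace (a : (Fin 2 → ℤ) → Ω → ℂ) (P : Measure Ω) : Submodule ℝ (Lp ℝ 2 P) :=
  (Submodule.span ℝ {ξ : Lp ℝ 2 P | ∃ (l : Fin 2 → ℤ) (z : ℂ), l ≠ 0 ∧
    ∀ᵐ ω ∂P, ((ξ ω : ℝ) : ℂ) = z * a l ω + conj z * a (-l) ω}).topologicalClosure

/-- The `q`-th Wiener chaos: the closure in `L²(P)` of the real linear combinations of the products
`H_{p₁}(ξ₁) ⋯ H_{p_k}(ξ_k)`, where `k ≥ 1`, `p₁ + ⋯ + p_k = q` and `(ξ₁, …, ξ_k)` is a standard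
Gaussian vector with entries in the Gaussian space. `Polynomial.hermite` is the family of
probabilists' Hermite polynomials. -/
def wienerChaos (a : (Fin 2 → ℤ) → Ω → ℂ) (P : Measure Ω) (q : ℕ) : Submodule ℝ (Lp ℝ 2 P) :=
  (Submodule.span ℝ {F : Lp ℝ 2 P | ∃ (k : ℕ) (p : Fin k → ℕ) (ξ : Fin k → Lp ℝ 2 P),
    1 ≤ k ∧ ∑ i, p i = q ∧ (∀ i, ξ i ∈ gaussianSpace a P) ∧
    (∀ i, HasLaw (ξ i) (gaussianReal 0 1) P) ∧ iIndepFun (fun i => (ξ i : Ω → ℝ)) P ∧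
    ∀ᵐ ω ∂P, F ω = ∏ i, Polynomial.aeval (ξ i ω) (Polynomial.hermite (p i))}).topologicalClosure

instance (a : (Fin 2 → ℤ) → Ω → ℂ) (P : Measure Ω) (q : ℕ) :
    CompleteSpace (wienerChaos a P q) :=
  (Submodule.isClosed_topologicalClosure _).completeSpace_coe

/-- The `q`-th chaotic component of `F ∈ L²(P)`: its orthogonal projection onto the `q`-th Wiener
chaos. -/
def chaosComponent (a : (Fin 2 → ℤ) → Ω → ℂ) (P : Measure Ω) (q : ℕ) (F : Lp ℝ 2 P) : Lp ℝ 2 P :=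
  (wienerChaos a P q).starProjection F

end ArithmeticWave

end

noncomputable section

namespace ArithmeticWave

open UnitAddTorus

/-!
Expanding the Dirac mass at `0` in Hermite polynomials suggests that the `q`-th chaotic component
of the Leray measure is `(2π)^{-1/2} H_q(0) / q! ∫ H_q(T_n(x)) dx`. Averaging the approximations
`(2ε)⁻¹ 1_{|T_n(x)| < ε}` against products of Hermite polynomials of an orthonormal Gaussian family
proves this: only the component of the product along `H_q(T_n(x))` is seen. The variance of the
`2q`-th component is therefore `(2π)⁻¹ 4^{-q} (2q choose q) ∫ r_n ^ (2q)`.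

The density of `(T_n(x), T_n(0))` at the origin is `(2π)⁻¹ (1 - r_n(x)²)^{-1/2}`. Its
integral is the second moment of the Leray measure, and its power series is the sum of the variances
above. All of this is finite because `∫ r_n ^ (2q)` is at most a constant times `1 / q`: since
`Δr_n = -4π²n r_n` and `|∇r_n|² ≤ 2π²n (1 - r_n²)`, integrating `r_n ^ (k + 1) Δr_n` by parts gives
`(k + 3) ∫ r_n ^ (k + 2) ≤ (k + 1) ∫ r_n ^ k` for even `k`.

Finally `∫ r_n² = 1 / N_n` gives the second component, and `∫ r_n⁴ ≤ 3 / N_n²` bounds the rest: two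
circles with distinct centres meet in at most two points, so that `a + b + c + d = 0` has few
solutions on the circle of radius `√n`.
-/

/-! ### Fourier analysis on the torus -/

section Torus

variable {d : Type*} [Fintype d]

instance : IsProbabilityMeasure (volume : Measure UnitAddCircle) :=
  ⟨UnitAddCircle.measure_univ⟩

theorem integrable_of_continuous {X E : Type*} [TopologicalSpace X] [CompactSpace X]
    [MeasurableSpace X] [OpensMeasurableSpace X] [NormedAddCommGroup E]
    {μ : Measure X} [IsFiniteMeasureOnCompacts μ] {F : X → E} (hF : Continuous F) :
    Integrable F μ :=
  hF.integrable_of_hasCompactSupport (HasCompactSupport.of_compactSpace F)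

theorem norm_mFourier_apply (l : d → ℤ) (x : UnitAddTorus d) : ‖mFourier l x‖ = 1 := by
  simp only [mFourier, fourier_apply, ContinuousMap.coe_mk, norm_prod, Circle.norm_coe,
    Finset.prod_const_one]

theorem mFourier_re_sq_add_im_sq (l : d → ℤ) (x : UnitAddTorus d) :
    (mFourier l x).re ^ 2 + (mFourier l x).im ^ 2 = 1 := by
  have h := Complex.sq_norm_sub_sq_re (mFourier l x)
  rw [norm_mFourier_apply] at h
  linarith

theorem mFourier_apply_add (l : d → ℤ) (x y : UnitAddTorus d) :
    mFourier l (x + y) = mFourier l x * mFourier l y := by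
  simp only [mFourier, fourier_apply, smul_add, AddCircle.toCircle_add, Pi.add_apply,
    ContinuousMap.coe_mk, Circle.coe_mul, Finset.prod_mul_distrib]

theorem mFourier_apply_neg (l : d → ℤ) (x : UnitAddTorus d) :
    mFourier l (-x) = conj (mFourier l x) := by
  simp only [mFourier, fourier_apply, smul_neg, AddCircle.toCircle_neg, Pi.neg_apply,
    ContinuousMap.coe_mk, Circle.coe_inv_eq_conj, map_prod]

theorem mFourier_apply_single [DecidableEq d] (l : d → ℤ) (i : d) (y : UnitAddCircle) :
    mFourier l (Pi.single i y) = fourier (l i) y := by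
  rw [mFourier, ContinuousMap.coe_mk,
    Fintype.prod_eq_single i fun j hj => by rw [Pi.single_eq_of_ne hj, fourier_eval_zero],
    Pi.single_eq_same]

theorem integral_mFourier_eq_zero {l : d → ℤ} (hl : l ≠ 0) :
    ∫ x : UnitAddTorus d, mFourier l x = 0 := by
  classical
  obtain ⟨i, hi⟩ := Function.ne_iff.mp hl
  set y : UnitAddTorus d := Pi.single i ((1 / 2 / l i : ℝ) : UnitAddCircle)
  have hy : mFourier l y = -1 := by
    have h := fourier_add_half_inv_index hi one_pos (0 : UnitAddCircle)
    rwa [zero_add, fourier_eval_zero, ← mFourier_apply_single] at h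
  have hshift : ∫ x, mFourier l x = -∫ x, mFourier l x := by
    rw [← integral_neg, ← integral_add_right_eq_self (mFourier l) y]
    simp only [mFourier_apply_add, hy, mul_neg_one]
  exact self_eq_neg.mp hshift

theorem integral_sum_mFourier {ι : Type*} (s : Finset ι) (f : ι → d → ℤ) :
    ∫ x : UnitAddTorus d, ∑ j ∈ s, mFourier (f j) x = (s.filter fun j => f j = 0).card := by
  rw [integral_finsetSum _ fun j _ => integrable_of_continuous (mFourier (f j)).continuous,
    Finset.card_filter, Nat.cast_sum]
  refine Finset.sum_congr rfl fun j _ => ?_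
  split_ifs with h
  · simp [h, mFourier_zero]
  · simpa using integral_mFourier_eq_zero h

variable [DecidableEq d]

/-- `F'` is the partial derivative of `F` in the direction of the `i`-th coordinate of the torus.
Differentiability is required along each coordinate line separately. -/
def HasPartialDeriv {E : Type*} [NormedAddCommGroup E] [NormedSpace ℝ E] (i : d)
    (F F' : UnitAddTorus d → E) : Prop :=
  ∀ (x : UnitAddTorus d) (t : ℝ), HasDerivAt (fun t : ℝ => F (x + Pi.single i (t : UnitAddCircle)))
    (F' (x + Pi.single i (t : UnitAddCircle))) t

theorem hasPartialDeriv_mFourier (l : d → ℤ) (i : d) :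
    HasPartialDeriv i (mFourier l) fun x => 2 * Real.pi * Complex.I * l i * mFourier l x := by
  intro x t
  simp only [mFourier_apply_add, mFourier_apply_single]
  refine ((hasDerivAt_fourier 1 (l i) t).const_mul (mFourier l x)).congr_deriv ?_
  simp only [Complex.ofReal_one, div_one]
  ring

theorem hasPartialDeriv_re_mFourier (l : d → ℤ) (i : d) :
    HasPartialDeriv i (fun x => (mFourier l x).re)
      fun x => -(2 * Real.pi * l i * (mFourier l x).im) := fun x t =>
  (Complex.reCLM.hasFDerivAt.comp_hasDerivAt t (hasPartialDeriv_mFourier l i x t)).congr_deriv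
    (by simp [Complex.mul_re])

theorem hasPartialDeriv_im_mFourier (l : d → ℤ) (i : d) :
    HasPartialDeriv i (fun x => (mFourier l x).im)
      fun x => 2 * Real.pi * l i * (mFourier l x).re := fun x t =>
  (Complex.imCLM.hasFDerivAt.comp_hasDerivAt t (hasPartialDeriv_mFourier l i x t)).congr_deriv
    (by simp [Complex.mul_im])

theorem HasPartialDeriv.integral_eq_zero {E : Type*} [NormedAddCommGroup E] [NormedSpace ℝ E]
    {i : d} {F F' : UnitAddTorus d → E} (h : HasPartialDeriv i F F') (hF : Continuous F)
    (hF' : Continuous F') : ∫ x, F' x = 0 := by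
  obtain ⟨C, hC⟩ := isCompact_univ.exists_bound_of_continuousOn (f := F') hF'.continuousOn
  have hshift {G : UnitAddTorus d → E} (hG : Continuous G) (t : ℝ) :
      Continuous fun x : UnitAddTorus d => G (x + Pi.single i (t : UnitAddCircle)) :=
    hG.comp (continuous_add_const _)
  have hderiv := (hasDerivAt_integral_of_dominated_loc_of_deriv_le
    (μ := (volume : Measure (UnitAddTorus d))) (x₀ := (0 : ℝ)) (s := Set.univ)
    (F := fun (t : ℝ) x => F (x + Pi.single i (t : UnitAddCircle)))
    (F' := fun (t : ℝ) x => F' (x + Pi.single i (t : UnitAddCircle)))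
    (bound := fun _ => C) univ_mem
    (Eventually.of_forall fun t => (hshift hF t).aestronglyMeasurable)
    (integrable_of_continuous (hshift hF 0)) (hshift hF' 0).aestronglyMeasurable
    (Eventually.of_forall fun x t _ => hC _ (Set.mem_univ _))
    (integrable_const _) (Eventually.of_forall fun x t _ => h x t)).2
  simp only [integral_add_right_eq_self] at hderiv
  exact hderiv.unique (hasDerivAt_const _ _)

theorem HasPartialDeriv.integral_pow_succ_mul {i : d} {f f' f'' : UnitAddTorus d → ℝ}
    (h : HasPartialDeriv i f f') (h' : HasPartialDeriv i f' f'') (hf : Continuous f)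
    (hf' : Continuous f') (hf'' : Continuous f'') (k : ℕ) :
    ∫ x, f x ^ (k + 1) * f'' x = -((k + 1) * ∫ x, f x ^ k * f' x ^ 2) := by
  have hproduct : HasPartialDeriv i (fun x => f x ^ (k + 1) * f' x)
      fun x => (k + 1) * (f x ^ k * f' x ^ 2) + f x ^ (k + 1) * f'' x := fun x t =>
    (((h x t).pow (k + 1)).mul (h' x t)).congr_deriv (by push_cast; simp; ring)
  have hzero := hproduct.integral_eq_zero (by fun_prop) (by fun_prop)
  rw [integral_add (integrable_of_continuous (by fun_prop))
    (integrable_of_continuous (by fun_prop)), integral_const_mul] at hzero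
  linarith

end Torus

/-! ### Lattice points on a circle -/

theorem latticeCount_pos {n : ℕ} (hn : n ∈ sumsOfTwoSquares) : 0 < latticeCount n := by
  obtain ⟨a, b, h⟩ := hn
  exact Finset.card_pos.mpr ⟨![a, b], by rw [mem_latticePoints]; simp [h]⟩

theorem ne_zero_of_mem_latticePoints {n : ℕ} (hn : 0 < n) {l : Fin 2 → ℤ}
    (h : l ∈ latticePoints n) : l ≠ 0 := by
  rintro rfl
  rw [mem_latticePoints] at h
  simp only [Pi.zero_apply] at h
  lia

theorem neg_mem_latticePoints {n : ℕ} {l : Fin 2 → ℤ} (h : l ∈ latticePoints n) :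
    -l ∈ latticePoints n := by
  rw [mem_latticePoints] at *
  simpa using h

theorem sum_latticePoints_neg {M : Type*} [AddCommMonoid M] (n : ℕ) (f : (Fin 2 → ℤ) → M) :
    ∑ l ∈ latticePoints n, f (-l) = ∑ l ∈ latticePoints n, f l :=
  Finset.sum_bij' (fun l _ => -l) (fun l _ => -l) (fun _ h => neg_mem_latticePoints h)
    (fun _ h => neg_mem_latticePoints h) (by simp) (by simp) (by simp)

/-- The rotation of the lattice `ℤ²` by a right angle, a symmetry of every set
`latticePoints n`. -/
def rotateLattice (l : Fin 2 → ℤ) : Fin 2 → ℤ := ![-l 1, l 0]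

theorem sum_latticePoints_rotate {M : Type*} [AddCommMonoid M] (n : ℕ) (f : (Fin 2 → ℤ) → M) :
    ∑ l ∈ latticePoints n, f (rotateLattice l) = ∑ l ∈ latticePoints n, f l := by
  refine Finset.sum_bij' (fun l _ => rotateLattice l) (fun l _ => -rotateLattice l)
    (fun l h => ?_) (fun l h => ?_) (fun l _ => ?_) (fun l _ => ?_) (by simp)
  · rw [mem_latticePoints] at *
    simp [rotateLattice, ← h, add_comm]
  · rw [mem_latticePoints] at *
    simp [rotateLattice, ← h, add_comm]
  all_goals
    funext i
    fin_cases i <;> simp [rotateLattice]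

theorem sum_latticePoints_linear_sq (n : ℕ) (u : Fin 2 → ℝ) :
    ∑ l ∈ latticePoints n, (∑ i, u i * l i) ^ 2 = n / 2 * latticeCount n * ∑ i, u i ^ 2 := by
  -- averaging over a quarter turn replaces the square of the linear form by `|u|² |l|² / 2`
  have hrotate := sum_latticePoints_rotate n fun l => (∑ i, u i * (l i : ℝ)) ^ 2
  have hconst : ∑ l ∈ latticePoints n, ((∑ i, u i * (l i : ℝ)) ^ 2 +
      (∑ i, u i * (rotateLattice l i : ℝ)) ^ 2) = ∑ _l ∈ latticePoints n, n * ∑ i, u i ^ 2 := by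
    refine Finset.sum_congr rfl fun l hl => ?_
    have hl' : (l 0 : ℝ) ^ 2 + (l 1 : ℝ) ^ 2 = n := by
      exact_mod_cast (mem_latticePoints n l).mp hl
    simp only [rotateLattice, Fin.sum_univ_two, Matrix.cons_val_zero, Matrix.cons_val_one,
      Int.cast_neg, ← hl']
    ring
  rw [Finset.sum_add_distrib, hrotate, Finset.sum_const, nsmul_eq_mul, ← latticeCount] at hconst
  linarith

theorem eq_zero_or_eq_zero_of_dotProduct_eq_zero {R : Type*} [CommRing R] [LinearOrder R]
    [IsStrictOrderedRing R] {u v w : Fin 2 → R} (hv : v ≠ 0) (huv : u ⬝ᵥ v = 0) (hwv : w ⬝ᵥ v = 0)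
    (huw : u ⬝ᵥ w = 0) : u = 0 ∨ w = 0 := by
  have hv' : v ⬝ᵥ v ≠ 0 := fun h => hv (dotProduct_self_eq_zero.mp h)
  have key (y : Fin 2 → R) (hyv : y ⬝ᵥ v = 0) (hcross : y 0 * v 1 - y 1 * v 0 = 0) : y = 0 := by
    refine dotProduct_self_eq_zero.mp ((mul_eq_zero.mp ?_).resolve_left hv')
    simp only [dotProduct, Fin.sum_univ_two] at *
    linear_combination (y 0 * v 0 + y 1 * v 1) * hyv + (y 0 * v 1 - y 1 * v 0) * hcross
  have hprod : (u 0 * v 1 - u 1 * v 0) * (w 0 * v 1 - w 1 * v 0) = 0 := by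
    simp only [dotProduct, Fin.sum_univ_two] at *
    linear_combination (v 0 * v 0 + v 1 * v 1) * huw - (w 0 * v 0 + w 1 * v 1) * huv
  exact (mul_eq_zero.mp hprod).imp (key u huv) (key w hwv)

theorem card_filter_sub_mem_latticePoints_le (n : ℕ) {v : Fin 2 → ℤ} (hv : v ≠ 0) :
    ((latticePoints n).filter fun c => v - c ∈ latticePoints n).card ≤ 2 := by
  rcases ((latticePoints n).filter fun c => v - c ∈ latticePoints n).eq_empty_or_nonempty
    with h | ⟨b, hb⟩
  · simp [h]
  refine (Finset.card_le_card (t := {b, v - b}) fun c hc => ?_).trans Finset.card_le_two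
  simp only [Finset.mem_filter, mem_latticePoints, Pi.sub_apply] at hb hc
  -- `c - b` and `c - (v - b)` are orthogonal to each other and both orthogonal to `v`
  have h : c - b = 0 ∨ c - (v - b) = 0 := by
    refine eq_zero_or_eq_zero_of_dotProduct_eq_zero hv ?_ ?_ ?_ <;>
      simp only [dotProduct, Fin.sum_univ_two, Pi.sub_apply] <;> nlinarith
  rw [Finset.mem_insert, Finset.mem_singleton]
  exact h.imp sub_eq_zero.mp sub_eq_zero.mp

theorem card_latticePoints_add_eq_zero (n : ℕ) :
    ((latticePoints n ×ˢ latticePoints n).filter fun p => p.1 + p.2 = 0).card =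
      latticeCount n := by
  refine Finset.card_bij' (fun p _ => p.1) (fun l _ => (l, -l)) (fun p hp => ?_) (fun l hl => ?_)
    (fun p hp => ?_) (fun l _ => rfl)
  · exact (Finset.mem_product.mp (Finset.mem_filter.mp hp).1).1
  · simpa using ⟨hl, neg_mem_latticePoints hl⟩
  · exact Prod.ext rfl (neg_eq_of_add_eq_zero_right (Finset.mem_filter.mp hp).2)

theorem card_latticePoints_add_add_eq_zero_le (n : ℕ) (v : Fin 2 → ℤ) :
    ((latticePoints n ×ˢ latticePoints n).filter fun p => v + (p.1 + p.2) = 0).card ≤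
      2 + if v = 0 then latticeCount n else 0 := by
  have hcard : ((latticePoints n ×ˢ latticePoints n).filter fun p => v + (p.1 + p.2) = 0).card ≤
      ((latticePoints n).filter fun c => -v - c ∈ latticePoints n).card := by
    refine Finset.card_le_card_of_injOn Prod.fst (fun p hp => ?_) fun p hp q hq hpq => ?_
    · simp only [Finset.coe_filter, Finset.mem_product, Set.mem_ofPred_eq] at hp ⊢
      rw [show -v - p.1 = p.2 by linear_combination (exp := 1) -hp.2]
      exact hp.1
    · simp only [Finset.coe_filter, Finset.mem_product, Set.mem_ofPred_eq] at hp hq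
      exact Prod.ext hpq (by linear_combination hp.2 - hq.2 - hpq)
  refine hcard.trans ?_
  split_ifs with hv
  · exact (Finset.card_filter_le _ _).trans (Nat.le_add_left _ _)
  · exact card_filter_sub_mem_latticePoints_le n (neg_ne_zero.mpr hv)

theorem card_latticePoints_add_add_add_eq_zero_le (n : ℕ) :
    (((latticePoints n ×ˢ latticePoints n) ×ˢ (latticePoints n ×ˢ latticePoints n)).filter
      fun p => p.1.1 + p.1.2 + (p.2.1 + p.2.2) = 0).card ≤ 3 * latticeCount n ^ 2 := by
  set S := latticePoints n ×ˢ latticePoints n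
  have hS : S.card = latticeCount n ^ 2 := by rw [Finset.card_product, sq, latticeCount]
  calc ((S ×ˢ S).filter fun p => p.1.1 + p.1.2 + (p.2.1 + p.2.2) = 0).card
      = ∑ p ∈ S, (S.filter fun q => p.1 + p.2 + (q.1 + q.2) = 0).card := by
        simp only [Finset.card_filter, Finset.sum_product]
    _ ≤ ∑ p ∈ S, (2 + if p.1 + p.2 = 0 then latticeCount n else 0) :=
        Finset.sum_le_sum fun p _ => card_latticePoints_add_add_eq_zero_le n (p.1 + p.2)
    _ = 3 * latticeCount n ^ 2 := by
        rw [Finset.sum_add_distrib, Finset.sum_const, hS, ← Finset.sum_filter, Finset.sum_const,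
          card_latticePoints_add_eq_zero, smul_eq_mul, smul_eq_mul]
        ring

/-! ### The covariance function -/

theorem waveCov_zero {n : ℕ} (hn : n ∈ sumsOfTwoSquares) : waveCov n 0 = 1 := by
  have h0 (l : Fin 2 → ℤ) : mFourier l (0 : Torus) = 1 := by simp [mFourier]
  simp only [waveCov, h0, Complex.one_re, Finset.sum_const, nsmul_eq_mul, mul_one]
  exact inv_mul_cancel₀ (by exact_mod_cast (latticeCount_pos hn).ne')

@[fun_prop]
theorem continuous_waveCov (n : ℕ) : Continuous (waveCov n) := by
  unfold waveCov
  fun_prop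

theorem integrable_waveCov_pow (n k : ℕ) : Integrable fun x => waveCov n x ^ k :=
  integrable_of_continuous (by fun_prop)

theorem ofReal_waveCov (n : ℕ) (x : Torus) :
    (waveCov n x : ℂ) = (latticeCount n : ℂ)⁻¹ * ∑ l ∈ latticePoints n, mFourier l x := by
  have hreal :
      conj (∑ l ∈ latticePoints n, mFourier l x) = ∑ l ∈ latticePoints n, mFourier l x := by
    rw [map_sum, ← sum_latticePoints_neg n fun l => mFourier l x]
    simp only [mFourier_neg]
  rw [waveCov, ← Complex.re_sum, Complex.ofReal_mul, Complex.conj_eq_iff_re.mp hreal,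
    Complex.ofReal_inv, Complex.ofReal_natCast]

theorem ofReal_waveCov_sq (n : ℕ) (x : Torus) :
    ((waveCov n x ^ 2 : ℝ) : ℂ) = (latticeCount n : ℂ)⁻¹ ^ 2 *
      ∑ p ∈ latticePoints n ×ˢ latticePoints n, mFourier (p.1 + p.2) x := by
  rw [Complex.ofReal_pow, ofReal_waveCov, mul_pow, sq (∑ l ∈ latticePoints n, _),
    Finset.sum_mul_sum, Finset.sum_product]
  simp only [mFourier_add]

theorem integral_waveCov_sq (n : ℕ) : ∫ x, waveCov n x ^ 2 = (latticeCount n : ℝ)⁻¹ := by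
  apply Complex.ofReal_injective
  rw [← integral_complex_ofReal]
  simp only [ofReal_waveCov_sq]
  rw [integral_const_mul, integral_sum_mFourier, card_latticePoints_add_eq_zero,
    Complex.ofReal_inv, Complex.ofReal_natCast]
  rcases eq_or_ne (latticeCount n : ℂ) 0 with h | h
  · simp [h]
  · field_simp

theorem integral_waveCov_pow_four (n : ℕ) : ∫ x, waveCov n x ^ 4 = (latticeCount n : ℝ)⁻¹ ^ 4 *
    (((latticePoints n ×ˢ latticePoints n) ×ˢ (latticePoints n ×ˢ latticePoints n)).filter
      fun p => p.1.1 + p.1.2 + (p.2.1 + p.2.2) = 0).card := by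
  apply Complex.ofReal_injective
  rw [← integral_complex_ofReal]
  have hexpand (x : Torus) : ((waveCov n x ^ 4 : ℝ) : ℂ) = (latticeCount n : ℂ)⁻¹ ^ 4 *
      ∑ p ∈ (latticePoints n ×ˢ latticePoints n) ×ˢ (latticePoints n ×ˢ latticePoints n),
        mFourier (p.1.1 + p.1.2 + (p.2.1 + p.2.2)) x := by
    rw [show waveCov n x ^ 4 = (waveCov n x ^ 2) ^ 2 by ring, Complex.ofReal_pow,
      ofReal_waveCov_sq, mul_pow, ← pow_mul, sq (∑ p ∈ _, _), Finset.sum_mul_sum,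
      Finset.sum_product (latticePoints n ×ˢ latticePoints n)]
    simp only [mFourier_add]
  simp only [hexpand]
  rw [integral_const_mul, integral_sum_mFourier]
  push_cast
  rfl

theorem integral_waveCov_pow_four_le (n : ℕ) :
    ∫ x, waveCov n x ^ 4 ≤ 3 / (latticeCount n : ℝ) ^ 2 := by
  rw [integral_waveCov_pow_four]
  calc _ ≤ (latticeCount n : ℝ)⁻¹ ^ 4 * (3 * (latticeCount n : ℝ) ^ 2) := by
        gcongr
        exact_mod_cast card_latticePoints_add_add_add_eq_zero_le n
    _ = 3 / (latticeCount n : ℝ) ^ 2 := by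
      rcases eq_or_ne (latticeCount n : ℝ) 0 with h | h
      · simp [h]
      · field_simp

theorem waveCov_sq_add_mean_im_sq_le_one (n : ℕ) (x : Torus) :
    waveCov n x ^ 2 +
      (latticeCount n : ℝ)⁻¹ * ∑ l ∈ latticePoints n, (mFourier l x).im ^ 2 ≤ 1 := by
  have hre : waveCov n x ^ 2 ≤
      (latticeCount n : ℝ)⁻¹ * ∑ l ∈ latticePoints n, (mFourier l x).re ^ 2 := by
    rw [waveCov, ← div_eq_inv_mul, ← div_eq_inv_mul]
    exact sum_div_card_sq_le_sum_sq_div_card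
  calc _ ≤ (latticeCount n : ℝ)⁻¹ * ∑ l ∈ latticePoints n, (mFourier l x).re ^ 2 +
        (latticeCount n : ℝ)⁻¹ * ∑ l ∈ latticePoints n, (mFourier l x).im ^ 2 := by gcongr
    _ = (latticeCount n : ℝ)⁻¹ * latticeCount n := by
        simp only [← mul_add, ← Finset.sum_add_distrib, mFourier_re_sq_add_im_sq,
          Finset.sum_const, nsmul_one, latticeCount]
    _ ≤ 1 := inv_mul_le_one

theorem waveCov_sq_le_one (n : ℕ) (x : Torus) : waveCov n x ^ 2 ≤ 1 :=
  (le_add_of_nonneg_right (by positivity)).trans (waveCov_sq_add_mean_im_sq_le_one n x)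

/-- The `i`-th partial derivative of the covariance function. -/
def waveCovGrad (n : ℕ) (i : Fin 2) (x : Torus) : ℝ :=
  (latticeCount n : ℝ)⁻¹ * ∑ l ∈ latticePoints n, -(2 * Real.pi * l i * (mFourier l x).im)

/-- The second partial derivative of the covariance function in the direction of the `i`-th
coordinate. -/
def waveCovHess (n : ℕ) (i : Fin 2) (x : Torus) : ℝ :=
  (latticeCount n : ℝ)⁻¹ *
    ∑ l ∈ latticePoints n, -(2 * Real.pi * l i * (2 * Real.pi * l i * (mFourier l x).re))

@[fun_prop]
theorem continuous_waveCovGrad (n : ℕ) (i : Fin 2) : Continuous (waveCovGrad n i) := by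
  unfold waveCovGrad
  fun_prop

@[fun_prop]
theorem continuous_waveCovHess (n : ℕ) (i : Fin 2) : Continuous (waveCovHess n i) := by
  unfold waveCovHess
  fun_prop

theorem hasPartialDeriv_waveCov (n : ℕ) (i : Fin 2) :
    HasPartialDeriv i (waveCov n) (waveCovGrad n i) := fun x t =>
  (HasDerivAt.fun_sum fun l _ => hasPartialDeriv_re_mFourier l i x t).const_mul _

theorem hasPartialDeriv_waveCovGrad (n : ℕ) (i : Fin 2) :
    HasPartialDeriv i (waveCovGrad n i) (waveCovHess n i) := fun x t =>
  (HasDerivAt.fun_sum fun l _ =>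
    ((hasPartialDeriv_im_mFourier l i x t).const_mul (2 * Real.pi * l i)).neg).const_mul _

theorem waveCov_laplacian (n : ℕ) (x : Torus) :
    ∑ i, waveCovHess n i x = -(4 * Real.pi ^ 2 * n) * waveCov n x := by
  simp only [waveCovHess, waveCov, Fin.sum_univ_two, Finset.mul_sum, ← Finset.sum_add_distrib]
  refine Finset.sum_congr rfl fun l hl => ?_
  have hl' : (l 0 : ℝ) ^ 2 + (l 1 : ℝ) ^ 2 = n := by
    exact_mod_cast (mem_latticePoints n l).mp hl
  rw [← hl']
  ring

theorem sq_sum_mul_waveCovGrad_le (n : ℕ) (u : Fin 2 → ℝ) (x : Torus) :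
    (∑ i, u i * waveCovGrad n i x) ^ 2 ≤
      2 * Real.pi ^ 2 * n * (∑ i, u i ^ 2) * (1 - waveCov n x ^ 2) := by
  have hdir : ∑ i, u i * waveCovGrad n i x = -(2 * Real.pi) * (latticeCount n : ℝ)⁻¹ *
      ∑ l ∈ latticePoints n, (∑ i, u i * l i) * (mFourier l x).im := by
    simp only [waveCovGrad, Fin.sum_univ_two, Finset.mul_sum, ← Finset.sum_add_distrib]
    exact Finset.sum_congr rfl fun l _ => by ring
  have hcs := Finset.sum_mul_sq_le_sq_mul_sq (latticePoints n) (fun l => ∑ i, u i * (l i : ℝ))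
    fun l => (mFourier l x).im
  rw [sum_latticePoints_linear_sq] at hcs
  rw [hdir, mul_pow]
  calc _ ≤ (-(2 * Real.pi) * (latticeCount n : ℝ)⁻¹) ^ 2 * (n / 2 * latticeCount n *
        (∑ i, u i ^ 2) * ∑ l ∈ latticePoints n, (mFourier l x).im ^ 2) := by gcongr
    _ = 2 * Real.pi ^ 2 * n * (∑ i, u i ^ 2) *
        ((latticeCount n : ℝ)⁻¹ * ∑ l ∈ latticePoints n, (mFourier l x).im ^ 2) := by
        rcases eq_or_ne (latticeCount n : ℝ) 0 with h | h
        · simp [h]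
        · field_simp
    _ ≤ _ := by
        gcongr
        linarith [waveCov_sq_add_mean_im_sq_le_one n x]

theorem sum_waveCovGrad_sq_le (n : ℕ) (x : Torus) :
    ∑ i, waveCovGrad n i x ^ 2 ≤ 2 * Real.pi ^ 2 * n * (1 - waveCov n x ^ 2) := by
  have h := sq_sum_mul_waveCovGrad_le n (fun i => waveCovGrad n i x) x
  simp only [← sq] at h
  have hr : 0 ≤ 2 * Real.pi ^ 2 * n * (1 - waveCov n x ^ 2) :=
    mul_nonneg (by positivity) (sub_nonneg.mpr (waveCov_sq_le_one n x))
  have hG : 0 ≤ ∑ i, waveCovGrad n i x ^ 2 := by positivity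
  rcases hG.eq_or_lt with h0 | h0
  · rwa [← h0]
  · nlinarith

/-! ### Decay of the moments of the covariance function -/

theorem integral_waveCov_pow_mul_sum_waveCovGrad_sq (n k : ℕ) :
    (k + 1 : ℝ) * ∫ x, waveCov n x ^ k * ∑ i, waveCovGrad n i x ^ 2 =
      4 * Real.pi ^ 2 * n * ∫ x, waveCov n x ^ (k + 2) := by
  have hparts (i : Fin 2) := (hasPartialDeriv_waveCov n i).integral_pow_succ_mul
    (hasPartialDeriv_waveCovGrad n i) (by fun_prop) (by fun_prop) (by fun_prop) k
  have hlaplacian : ∫ x, waveCov n x ^ (k + 1) * ∑ i, waveCovHess n i x =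
      -(4 * Real.pi ^ 2 * n) * ∫ x, waveCov n x ^ (k + 2) := by
    rw [← integral_const_mul]
    refine integral_congr_ae (Eventually.of_forall fun x => ?_)
    simp only [waveCov_laplacian]
    ring
  simp only [Finset.mul_sum] at hlaplacian ⊢
  rw [integral_finsetSum _ fun i _ => integrable_of_continuous (by fun_prop)] at hlaplacian ⊢
  simp only [hparts, Finset.sum_neg_distrib, ← Finset.mul_sum] at hlaplacian
  linarith

theorem integral_waveCov_pow_add_two_le {n : ℕ} (hn : 0 < n) {k : ℕ} (hk : Even k) :
    (k + 3 : ℝ) * ∫ x, waveCov n x ^ (k + 2) ≤ (k + 1) * ∫ x, waveCov n x ^ k := by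
  have hgrad : ∫ x, waveCov n x ^ k * ∑ i, waveCovGrad n i x ^ 2 ≤
      2 * Real.pi ^ 2 * n * ((∫ x, waveCov n x ^ k) - ∫ x, waveCov n x ^ (k + 2)) := by
    rw [← integral_sub (integrable_waveCov_pow n k) (integrable_waveCov_pow n _),
      ← integral_const_mul]
    refine integral_mono (integrable_of_continuous (by fun_prop))
      (integrable_of_continuous (by fun_prop)) fun x => ?_
    calc _ ≤ waveCov n x ^ k * (2 * Real.pi ^ 2 * n * (1 - waveCov n x ^ 2)) :=
          mul_le_mul_of_nonneg_left (sum_waveCovGrad_sq_le n x) (hk.pow_nonneg _)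
      _ = _ := by ring
  have hpos : 0 < 2 * Real.pi ^ 2 * n := by positivity
  have h := integral_waveCov_pow_mul_sum_waveCovGrad_sq n k
  refine le_of_mul_le_mul_left ?_ hpos
  nlinarith

theorem integral_waveCov_pow_nonneg (n q : ℕ) : 0 ≤ ∫ x, waveCov n x ^ (2 * q) :=
  integral_nonneg fun _ => (even_two_mul q).pow_nonneg _

theorem integral_waveCov_pow_le {n : ℕ} (hn : 0 < n) (K j : ℕ) :
    (2 * (K + j) + 1 : ℝ) * ∫ x, waveCov n x ^ (2 * (K + j))
      ≤ (2 * K + 1) * ∫ x, waveCov n x ^ (2 * K) := by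
  induction j with
  | zero => simp
  | succ j ih =>
    have h := integral_waveCov_pow_add_two_le hn (even_two_mul (K + j))
    rw [← add_assoc, mul_add_one]
    push_cast at *
    linarith

theorem tendsto_integral_waveCov_pow {n : ℕ} (hn : 0 < n) :
    Tendsto (fun q : ℕ => ∫ x, (waveCov n x ^ 2) ^ q) atTop (𝓝 0) := by
  simp only [← pow_mul]
  refine squeeze_zero (integral_waveCov_pow_nonneg n) (fun q => ?_)
    tendsto_one_div_add_atTop_nhds_zero_nat
  have h := integral_waveCov_pow_le hn 0 q
  have h0 := integral_waveCov_pow_nonneg n q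
  simp only [zero_add, mul_zero, pow_zero, integral_const, probReal_univ, smul_eq_mul, mul_one,
    Nat.cast_zero] at h
  rw [le_div_iff₀ (by positivity)]
  nlinarith

theorem ae_lt_one_of_tendsto_integral_pow {α : Type*} [MeasurableSpace α] {μ : Measure α}
    [IsFiniteMeasure μ] {g : α → ℝ} (hg : 0 ≤ g) (h_int : ∀ q : ℕ, Integrable (fun x => g x ^ q) μ)
    (h : Tendsto (fun q : ℕ => ∫ x, g x ^ q ∂μ) atTop (𝓝 0)) : ∀ᵐ x ∂μ, g x < 1 := by
  have hle (q : ℕ) : μ.real {x | 1 ≤ g x} ≤ ∫ x, g x ^ q ∂μ := by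
    have hmono : μ.real {x | 1 ≤ g x} ≤ μ.real {x | 1 ≤ g x ^ q} :=
      measureReal_mono (Set.ofPred_subset_ofPred.mpr fun x hx => one_le_pow₀ hx)
    refine hmono.trans ?_
    simpa using mul_meas_ge_le_integral_of_nonneg
      (Eventually.of_forall fun x => pow_nonneg (hg x) q) (h_int q) 1
  have hzero := le_antisymm (ge_of_tendsto' h hle) measureReal_nonneg
  rw [measureReal_eq_zero_iff] at hzero
  simpa only [ae_iff, not_lt] using hzero

theorem ae_waveCov_sq_lt_one {n : ℕ} (hn : 0 < n) : ∀ᵐ x : Torus, waveCov n x ^ 2 < 1 :=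
  ae_lt_one_of_tendsto_integral_pow (fun _ => sq_nonneg _)
    (fun _ => integrable_of_continuous (by fun_prop)) (tendsto_integral_waveCov_pow hn)

/-! ### The expansion of `(1 - t)^{-1/2}` -/

/-- The coefficient of `t ^ q` in the power series of `(1 - t) ^ (-1 / 2)`. -/
def centralCoeff (q : ℕ) : ℝ := (Nat.centralBinom q : ℝ) / 4 ^ q

theorem centralCoeff_pos (q : ℕ) : 0 < centralCoeff q :=
  div_pos (by exact_mod_cast q.centralBinom_pos) (by positivity)

theorem centralCoeff_zero : centralCoeff 0 = 1 := by simp [centralCoeff]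

theorem centralCoeff_one : centralCoeff 1 = 1 / 2 := by
  norm_num [centralCoeff, Nat.centralBinom, Nat.choose]

theorem succ_mul_centralCoeff_succ (q : ℕ) :
    (q + 1 : ℝ) * centralCoeff (q + 1) = (q + 1 / 2) * centralCoeff q := by
  have h : (q + 1 : ℝ) * Nat.centralBinom (q + 1) = 2 * (2 * q + 1) * Nat.centralBinom q := by
    exact_mod_cast Nat.succ_mul_centralBinom_succ q
  rw [centralCoeff, mul_div_assoc', h, centralCoeff]
  field_simp
  ring

theorem ringChoose_half_eq_centralCoeff (q : ℕ) :
    Ring.choose ((1 / 2 : ℝ) + q - 1) q = centralCoeff q := by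
  rw [← Ring.multichoose_eq]
  induction q with
  | zero => simp [centralCoeff_zero]
  | succ q ih =>
    have hsucc := Ring.factorial_nsmul_multichoose_eq_ascPochhammer (1 / 2 : ℝ) (q + 1)
    rw [ascPochhammer_succ_right, Polynomial.smeval_mul,
      ← Ring.factorial_nsmul_multichoose_eq_ascPochhammer, ih] at hsucc
    simp only [nsmul_eq_mul, Polynomial.smeval_add, Polynomial.smeval_X, pow_one,
      Polynomial.smeval_natCast, pow_zero, mul_one] at hsucc
    refine mul_left_cancel₀ (Nat.cast_ne_zero.mpr (q + 1).factorial_ne_zero) (hsucc.trans ?_)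
    rw [Nat.factorial_succ]
    push_cast
    linear_combination -(q.factorial : ℝ) * succ_mul_centralCoeff_succ q

theorem hasSum_centralCoeff {t : ℝ} (ht : |t| < 1) :
    HasSum (fun q => centralCoeff q * t ^ q) (1 / √(1 - t)) := by
  have h := (Real.one_div_one_sub_rpow_hasFPowerSeriesOnBall_zero (1 / 2)).hasSum (y := t) (by
    rw [Metric.mem_eball, edist_zero_right, ← ofReal_norm]
    simpa using ht)
  simpa only [FormalMultilinearSeries.ofScalars_apply_eq, zero_add, smul_eq_mul,
    ringChoose_half_eq_centralCoeff, ← Real.sqrt_eq_rpow] using h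

theorem centralCoeff_div_le (q : ℕ) :
    centralCoeff q / (2 * q + 1) ≤ 2 * (centralCoeff q - centralCoeff (q + 1)) := by
  have hdiff : 2 * (centralCoeff q - centralCoeff (q + 1)) = centralCoeff q / (q + 1) := by
    field_simp
    linear_combination -2 * succ_mul_centralCoeff_succ q
  rw [hdiff]
  have hpos := (centralCoeff_pos q).le
  gcongr
  linarith [(q.cast_nonneg : (0 : ℝ) ≤ q)]

theorem centralCoeff_le_one (q : ℕ) : centralCoeff q ≤ 1 := by
  have hanti : Antitone centralCoeff := antitone_nat_of_succ_le fun q => by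
    have hpos : 0 ≤ centralCoeff q / (2 * q + 1) :=
      div_nonneg (centralCoeff_pos q).le (by positivity)
    linarith [centralCoeff_div_le q]
  exact centralCoeff_zero ▸ hanti (Nat.zero_le q)

theorem sum_centralCoeff_div_le (K M : ℕ) :
    ∑ j ∈ Finset.range M, centralCoeff (K + j) / (2 * (K + j) + 1) ≤ 2 := by
  calc _ ≤ ∑ j ∈ Finset.range M, 2 * (centralCoeff (K + j) - centralCoeff (K + (j + 1))) :=
        Finset.sum_le_sum fun j _ => by exact_mod_cast centralCoeff_div_le (K + j)
    _ = 2 * (centralCoeff K - centralCoeff (K + M)) := by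
        rw [← Finset.mul_sum, Finset.sum_range_sub' fun j => centralCoeff (K + j), add_zero]
    _ ≤ 2 := by linarith [centralCoeff_le_one K, centralCoeff_pos (K + M)]

theorem centralCoeff_mul_integral_waveCov_pow_nonneg (n q : ℕ) :
    0 ≤ centralCoeff q * ∫ x, waveCov n x ^ (2 * q) :=
  mul_nonneg (centralCoeff_pos q).le (integral_waveCov_pow_nonneg n q)

section Decay

variable {n : ℕ} (hn : 0 < n) (K : ℕ)
include hn

theorem sum_centralCoeff_mul_integral_le (M : ℕ) :
    ∑ j ∈ Finset.range M, centralCoeff (K + j) * ∫ x, waveCov n x ^ (2 * (K + j))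
      ≤ 2 * (2 * K + 1) * ∫ x, waveCov n x ^ (2 * K) := by
  have hI := integral_waveCov_pow_nonneg n K
  calc _ ≤ ∑ j ∈ Finset.range M, centralCoeff (K + j) / (2 * (K + j) + 1) *
        ((2 * K + 1) * ∫ x, waveCov n x ^ (2 * K)) := by
        refine Finset.sum_le_sum fun j _ => ?_
        rw [div_mul_eq_mul_div, le_div_iff₀ (by positivity), mul_right_comm, mul_assoc]
        exact mul_le_mul_of_nonneg_left (integral_waveCov_pow_le hn K j) (centralCoeff_pos _).le
    _ ≤ 2 * ((2 * K + 1) * ∫ x, waveCov n x ^ (2 * K)) := by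
        rw [← Finset.sum_mul]
        exact mul_le_mul_of_nonneg_right (sum_centralCoeff_div_le K M) (by positivity)
    _ = _ := by ring

theorem summable_centralCoeff_mul_integral :
    Summable fun j => centralCoeff (K + j) * ∫ x, waveCov n x ^ (2 * (K + j)) :=
  summable_of_sum_range_le (fun _ => centralCoeff_mul_integral_waveCov_pow_nonneg n _)
    (sum_centralCoeff_mul_integral_le hn K)

theorem tsum_centralCoeff_mul_integral_le :
    ∑' j, centralCoeff (K + j) * ∫ x, waveCov n x ^ (2 * (K + j))
      ≤ 2 * (2 * K + 1) * ∫ x, waveCov n x ^ (2 * K) :=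
  Real.tsum_le_of_sum_range_le (fun _ => centralCoeff_mul_integral_waveCov_pow_nonneg n _)
    (sum_centralCoeff_mul_integral_le hn K)

end Decay

theorem integrable_of_hasSum {α ι : Type*} [MeasurableSpace α] [Countable ι] {μ : Measure α}
    {F : ι → α → ℝ} {G : α → ℝ} (hF : ∀ i, Integrable (F i) μ)
    (hsum : Summable fun i => ∫ x, ‖F i x‖ ∂μ) (hG : ∀ᵐ x ∂μ, HasSum (fun i => F i x) (G x)) :
    Integrable G μ := by
  refine ⟨aestronglyMeasurable_of_tendsto_ae atTop
    (fun s => (integrable_finsetSum s fun i _ => hF i).aestronglyMeasurable) ?_, ?_⟩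
  · filter_upwards [hG] with x hx using hx
  rw [hasFiniteIntegral_iff_enorm]
  calc ∫⁻ x, ‖G x‖ₑ ∂μ ≤ ∫⁻ x, ∑' i, ‖F i x‖ₑ ∂μ := by
        refine lintegral_mono_ae ?_
        filter_upwards [hG] with x hx
        rw [← hx.tsum_eq]
        exact enorm_tsum_le_tsum_enorm
    _ = ∑' i, ∫⁻ x, ‖F i x‖ₑ ∂μ := lintegral_tsum fun i => (hF i).aestronglyMeasurable.enorm
    _ = ENNReal.ofReal (∑' i, ∫ x, ‖F i x‖ ∂μ) := by
        rw [ENNReal.ofReal_tsum_of_nonneg (fun i => integral_nonneg fun x => norm_nonneg _) hsum]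
        simp only [ofReal_integral_norm_eq_lintegral_enorm (hF _)]
    _ < ∞ := ENNReal.ofReal_lt_top

theorem hasSum_integral_of_hasSum {α ι : Type*} [MeasurableSpace α] [Countable ι] {μ : Measure α}
    {F : ι → α → ℝ} {G : α → ℝ} (hF : ∀ i, Integrable (F i) μ)
    (hsum : Summable fun i => ∫ x, ‖F i x‖ ∂μ) (hG : ∀ᵐ x ∂μ, HasSum (fun i => F i x) (G x)) :
    HasSum (fun i => ∫ x, F i x ∂μ) (∫ x, G x ∂μ) := by
  rw [← integral_congr_ae (hG.mono fun x hx => hx.tsum_eq)]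
  exact hasSum_integral_of_summable_integral_norm hF hsum

theorem ae_hasSum_inv_sqrt {n : ℕ} (hn : 0 < n) :
    ∀ᵐ x, HasSum (fun q => centralCoeff q * waveCov n x ^ (2 * q))
      (1 / √(1 - waveCov n x ^ 2)) := by
  filter_upwards [ae_waveCov_sq_lt_one hn] with x hx
  simpa only [pow_mul] using
    hasSum_centralCoeff ((abs_of_nonneg (sq_nonneg (waveCov n x))).trans_lt hx)

theorem summable_integral_norm_centralCoeff_mul {n : ℕ} (hn : 0 < n) :
    Summable fun q => ∫ x, ‖centralCoeff q * waveCov n x ^ (2 * q)‖ := by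
  simp only [Real.norm_of_nonneg (mul_nonneg (centralCoeff_pos _).le
    ((even_two_mul _).pow_nonneg (waveCov n _))), integral_const_mul]
  simpa only [zero_add] using summable_centralCoeff_mul_integral hn 0

theorem integrable_inv_sqrt {n : ℕ} (hn : 0 < n) :
    Integrable fun x => 1 / √(1 - waveCov n x ^ 2) :=
  integrable_of_hasSum (fun _ => (integrable_waveCov_pow n _).const_mul _)
    (summable_integral_norm_centralCoeff_mul hn) (ae_hasSum_inv_sqrt hn)

theorem hasSum_integral_inv_sqrt {n : ℕ} (hn : 0 < n) :
    HasSum (fun q => centralCoeff q * ∫ x, waveCov n x ^ (2 * q))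
      (∫ x, 1 / √(1 - waveCov n x ^ 2)) := by
  simpa only [integral_const_mul] using
    hasSum_integral_of_hasSum (fun _ => (integrable_waveCov_pow n _).const_mul _)
      (summable_integral_norm_centralCoeff_mul hn) (ae_hasSum_inv_sqrt hn)

/-! ### Hermite polynomials and the standard Gaussian measure -/

/-- The value at `x` of the `p`-th probabilists' Hermite polynomial. -/
def hermiteFun (p : ℕ) (x : ℝ) : ℝ := Polynomial.aeval x (Polynomial.hermite p)

theorem derivative_hermite_succ (n : ℕ) :
    Polynomial.derivative (Polynomial.hermite (n + 1)) = (n + 1) * Polynomial.hermite n := by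
  induction n with
  | zero => simp
  | succ n ih =>
    have hcast : ((n + 1 : Polynomial ℤ)) = ((n + 1 : ℕ) : Polynomial ℤ) := by push_cast; rfl
    rw [Polynomial.hermite_succ (n + 1), Polynomial.derivative_sub, Polynomial.derivative_mul,
      Polynomial.derivative_X, ih, hcast, Polynomial.derivative_natCast_mul]
    push_cast
    linear_combination -((n : Polynomial ℤ) + 1) * Polynomial.hermite_succ n

theorem hermiteFun_zero (x : ℝ) : hermiteFun 0 x = 1 := by simp [hermiteFun]

theorem hermiteFun_succ (p : ℕ) (x : ℝ) : hermiteFun (p + 1) x =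
    x * hermiteFun p x - Polynomial.aeval x (Polynomial.derivative (Polynomial.hermite p)) := by
  simp [hermiteFun, Polynomial.hermite_succ]

theorem hasDerivAt_hermiteFun (p : ℕ) (x : ℝ) : HasDerivAt (hermiteFun p)
    (Polynomial.aeval x (Polynomial.derivative (Polynomial.hermite p))) x :=
  Polynomial.hasDerivAt_aeval _ x

@[fun_prop]
theorem continuous_hermiteFun (p : ℕ) : Continuous (hermiteFun p) :=
  Polynomial.continuous_aeval _

theorem hasDerivAt_hermiteFun_succ (p : ℕ) (x : ℝ) :
    HasDerivAt (hermiteFun (p + 1)) ((p + 1) * hermiteFun p x) x :=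
  (hasDerivAt_hermiteFun (p + 1) x).congr_deriv (by
    rw [derivative_hermite_succ]
    simp [hermiteFun])

theorem hermiteFun_add_two_zero (p : ℕ) : hermiteFun (p + 2) 0 = -(p + 1) * hermiteFun p 0 := by
  rw [hermiteFun_succ, derivative_hermite_succ]
  simp [hermiteFun]
  ring

theorem hermiteFun_two_mul_zero_sq (m : ℕ) :
    hermiteFun (2 * m) 0 ^ 2 = (2 * m).factorial * centralCoeff m := by
  induction m with
  | zero => simp [hermiteFun_zero, centralCoeff_zero]
  | succ m ih =>
    rw [mul_add, mul_one, hermiteFun_add_two_zero, mul_pow, ih, Nat.factorial_succ,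
      Nat.factorial_succ]
    push_cast
    linear_combination
      -(2 * (2 * m + 1) * (2 * m).factorial : ℝ) * succ_mul_centralCoeff_succ m

theorem integrable_aeval_gaussianReal (p : Polynomial ℤ) :
    Integrable (fun x : ℝ => Polynomial.aeval x p) (gaussianReal 0 1) := by
  induction p using Polynomial.induction_on' with
  | add p q hp hq =>
    simp only [map_add]
    exact hp.add hq
  | monomial n c =>
    simp only [Polynomial.aeval_monomial]
    refine Integrable.const_mul ?_ _
    refine (integrable_norm_iff (by fun_prop)).mp ?_
    simpa using (memLp_id_gaussianReal (μ := 0) (v := 1) n).integrable_norm_pow'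

theorem integrable_hermiteFun_mul (p q : ℕ) :
    Integrable (fun x => hermiteFun p x * hermiteFun q x) (gaussianReal 0 1) := by
  simpa [hermiteFun] using
    integrable_aeval_gaussianReal (Polynomial.hermite p * Polynomial.hermite q)

theorem memLp_hermiteFun (p : ℕ) : MemLp (hermiteFun p) 2 (gaussianReal 0 1) := by
  rw [memLp_two_iff_integrable_sq (by fun_prop)]
  simpa only [sq] using integrable_hermiteFun_mul p p

theorem integrable_gaussianReal_iff {f : ℝ → ℂ} :
    Integrable f (gaussianReal 0 1) ↔ Integrable fun x => (gaussianPDFReal 0 1 x : ℂ) * f x := by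
  rw [gaussianReal_of_var_ne_zero _ one_ne_zero, integrable_withDensity_iff_integrable_smul'
    (by fun_prop) (Eventually.of_forall fun x => gaussianPDF_lt_top)]
  simp [toReal_gaussianPDF]

theorem hasDerivAt_gaussianPDFReal (x : ℝ) :
    HasDerivAt (gaussianPDFReal 0 1) (-x * gaussianPDFReal 0 1 x) x := by
  have hexponent : HasDerivAt (fun x : ℝ => -x ^ 2 / 2) (-x) x :=
    (((hasDerivAt_pow 2 x).neg).div_const 2).congr_deriv (by ring)
  have hpdf : gaussianPDFReal 0 1 = fun x : ℝ => (√(2 * Real.pi))⁻¹ * Real.exp (-x ^ 2 / 2) := by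
    funext x
    simp [gaussianPDFReal]
  rw [hpdf]
  exact (hexponent.exp.const_mul _).congr_deriv (by ring)

theorem hasDerivAt_hermiteFun_mul_gaussianPDFReal (p : ℕ) (x : ℝ) :
    HasDerivAt (fun x => hermiteFun p x * gaussianPDFReal 0 1 x)
      (-(hermiteFun (p + 1) x * gaussianPDFReal 0 1 x)) x :=
  ((hasDerivAt_hermiteFun p x).mul (hasDerivAt_gaussianPDFReal x)).congr_deriv (by
    rw [hermiteFun_succ]
    ring)

theorem integral_mul_hermiteFun_succ {f f' : ℝ → ℂ} (p : ℕ) (hf : ∀ x, HasDerivAt f (f' x) x)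
    (h : Integrable (fun x => f x * hermiteFun p x) (gaussianReal 0 1))
    (hderiv : Integrable (fun x => f' x * hermiteFun p x) (gaussianReal 0 1))
    (hsucc : Integrable (fun x => f x * hermiteFun (p + 1) x) (gaussianReal 0 1)) :
    ∫ x, f x * hermiteFun (p + 1) x ∂gaussianReal 0 1
      = ∫ x, f' x * hermiteFun p x ∂gaussianReal 0 1 := by
  simp only [integral_gaussianReal_eq_integral_smul one_ne_zero, Complex.real_smul]
  have hcomm (g : ℝ → ℂ) (q : ℕ) : (fun x => (gaussianPDFReal 0 1 x : ℂ) * (g x * hermiteFun q x))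
      = fun x => g x * ((hermiteFun q x * gaussianPDFReal 0 1 x : ℝ) : ℂ) := by
    funext x
    push_cast
    ring
  rw [integrable_gaussianReal_iff, hcomm] at h hderiv hsucc
  simp only [hcomm]
  have hparts := integral_mul_deriv_eq_deriv_mul_of_integrable (fun x _ => hf x)
    (fun x _ => (hasDerivAt_hermiteFun_mul_gaussianPDFReal p x).ofReal_comp)
    (by simpa [Pi.mul_def] using hsucc.neg) hderiv h
  simpa [integral_neg] using hparts

theorem integral_exp_mul_hermiteFun (s : ℝ) (p : ℕ) :
    ∫ x : ℝ, Complex.exp (s * x * Complex.I) * hermiteFun p x ∂gaussianReal 0 1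
      = (s * Complex.I) ^ p * Complex.exp (-s ^ 2 / 2) := by
  have h_int (p : ℕ) : Integrable (fun x : ℝ => Complex.exp (s * x * Complex.I) * hermiteFun p x)
      (gaussianReal 0 1) :=
    (integrable_aeval_gaussianReal _).ofReal.bdd_mul (c := 1) (by fun_prop)
      (Eventually.of_forall fun x => by rw [← Complex.ofReal_mul, Complex.norm_exp_ofReal_mul_I])
  induction p with
  | zero =>
    have h := charFun_gaussianReal (μ := 0) (v := 1) s
    rw [charFun_apply_real] at h
    simpa [hermiteFun_zero, neg_div] using h
  | succ p ih =>
    have hderiv (x : ℝ) : HasDerivAt (fun x : ℝ => Complex.exp (s * x * Complex.I))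
        (s * Complex.I * Complex.exp (s * x * Complex.I)) x :=
      ((Complex.ofRealCLM.hasDerivAt.const_mul (s : ℂ)).mul_const _).cexp.congr_deriv (by
        simp only [Complex.ofRealCLM_apply, Complex.ofReal_one]
        ring)
    rw [integral_mul_hermiteFun_succ p hderiv (h_int p) ?_ (h_int (p + 1))]
    · simp only [mul_assoc ((s : ℂ) * Complex.I)]
      rw [integral_const_mul, ih]
      ring
    · simp only [mul_assoc ((s : ℂ) * Complex.I)]
      exact (h_int p).const_mul _

theorem integral_hermiteFun_succ (p : ℕ) : ∫ x, hermiteFun (p + 1) x ∂gaussianReal 0 1 = 0 := by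
  have h := integral_exp_mul_hermiteFun 0 (p + 1)
  simp only [Complex.ofReal_zero, zero_mul, Complex.exp_zero, one_mul, integral_complex_ofReal,
    pow_succ, mul_zero] at h
  exact_mod_cast h

theorem integral_hermiteFun_sq (p : ℕ) :
    ∫ x, hermiteFun p x * hermiteFun p x ∂gaussianReal 0 1 = p.factorial := by
  induction p with
  | zero => simp [hermiteFun_zero]
  | succ p ih =>
    have h := integral_mul_hermiteFun_succ (f := fun x => hermiteFun (p + 1) x)
      (f' := fun x => ((p + 1) * hermiteFun p x : ℝ)) p
      (fun x => (hasDerivAt_hermiteFun_succ p x).ofReal_comp)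
      (by exact_mod_cast (integrable_hermiteFun_mul (p + 1) p).ofReal)
      (by
        simp only [← Complex.ofReal_mul, mul_assoc]
        exact ((integrable_hermiteFun_mul p p).const_mul ((p : ℝ) + 1)).ofReal)
      (by exact_mod_cast (integrable_hermiteFun_mul (p + 1) (p + 1)).ofReal)
    simp only [← Complex.ofReal_mul, mul_assoc] at h
    rw [integral_complex_ofReal, integral_complex_ofReal, integral_const_mul, ih] at h
    rw [Nat.factorial_succ]
    exact_mod_cast h

/-! ### Averages over small intervals -/

/-- The approximation `(2ε)⁻¹ 1_{(-ε, ε)}` of the Dirac mass at the origin. -/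
def deltaApprox (ε : ℝ) : ℝ → ℝ := (Set.Ioo (-ε) ε).indicator fun _ => (2 * ε)⁻¹

@[fun_prop]
theorem measurable_deltaApprox (ε : ℝ) : Measurable (deltaApprox ε) :=
  measurable_const.indicator measurableSet_Ioo

theorem deltaApprox_nonneg {ε : ℝ} (hε : 0 < ε) (x : ℝ) : 0 ≤ deltaApprox ε x :=
  Set.indicator_nonneg (fun _ _ => by positivity) _

theorem norm_deltaApprox_le (ε x : ℝ) : ‖deltaApprox ε x‖ ≤ |(2 * ε)⁻¹| :=
  norm_indicator_le_norm_self _ _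

theorem integral_deltaApprox_mul {ε : ℝ} (hε : 0 < ε) (g : ℝ → ℝ) :
    ∫ x, deltaApprox ε x * g x = (2 * ε)⁻¹ * ∫ x in (-ε)..ε, g x := by
  rw [intervalIntegral.integral_of_le (by linarith), integral_Ioc_eq_integral_Ioo,
    ← integral_const_mul, ← integral_indicator measurableSet_Ioo]
  refine integral_congr_ae (Eventually.of_forall fun x => ?_)
  simp only [deltaApprox, Set.indicator_apply, ite_mul, zero_mul]

theorem tendsto_integral_deltaApprox_mul {g : ℝ → ℝ} (hg : Continuous g) :
    Tendsto (fun ε => ∫ x, deltaApprox ε x * g x) (𝓝[>] 0) (𝓝 (g 0)) := by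
  have hderiv : HasDerivAt (fun u => ∫ x in (0 : ℝ)..u, g x) (g 0) 0 :=
    (hg.integral_hasStrictDerivAt 0 0).hasDerivAt
  have hleft := hderiv.tendsto_slope_zero_left.comp
    (show Tendsto (fun x : ℝ => -x) (𝓝[>] 0) (𝓝[<] 0) by
      simpa using tendsto_neg_nhdsGT (a := (0 : ℝ)))
  have hmean := (hderiv.tendsto_slope_zero_right.add hleft).const_mul (1 / 2)
  rw [show 1 / 2 * (g 0 + g 0) = g 0 by ring] at hmean
  refine hmean.congr' ?_
  filter_upwards [self_mem_nhdsWithin] with ε (hε : 0 < ε)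
  rw [integral_deltaApprox_mul hε,
    ← intervalIntegral.integral_add_adjacent_intervals (hg.intervalIntegrable (-ε) 0)
      (hg.intervalIntegrable 0 ε), intervalIntegral.integral_symm 0 (-ε)]
  simp only [Function.comp_apply, zero_add, intervalIntegral.integral_same, sub_zero, smul_eq_mul]
  field_simp
  ring

theorem tendsto_integral_deltaApprox_mul_hermiteFun (q : ℕ) :
    Tendsto (fun ε => ∫ x, deltaApprox ε x * hermiteFun q x ∂gaussianReal 0 1) (𝓝[>] 0)
      (𝓝 ((√(2 * Real.pi))⁻¹ * hermiteFun q 0)) := by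
  have hcont : Continuous (gaussianPDFReal 0 1) :=
    continuous_iff_continuousAt.mpr fun x => (hasDerivAt_gaussianPDFReal x).continuousAt
  have h := tendsto_integral_deltaApprox_mul (hcont.mul (continuous_hermiteFun q))
  have hpdf : gaussianPDFReal 0 1 0 = (√(2 * Real.pi))⁻¹ := by simp [gaussianPDFReal]
  simp only [Pi.mul_apply, hpdf] at h
  refine h.congr fun ε => ?_
  rw [integral_gaussianReal_eq_integral_smul one_ne_zero]
  refine integral_congr_ae (Eventually.of_forall fun x => ?_)
  simp only [smul_eq_mul]
  ring

/-! ### Gaussian linear spaces -/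

section GaussianLinearSpace

variable {Ω : Type*} [MeasurableSpace Ω] {P : Measure Ω}

theorem aemeasurable_Lp (ξ : Lp ℝ 2 P) : AEMeasurable ξ P :=
  (Lp.aestronglyMeasurable ξ).aemeasurable

theorem inner_eq_integral_mul (ξ η : Lp ℝ 2 P) : inner ℝ ξ η = ∫ ω, ξ ω * η ω ∂P := by
  simp [L2.inner_def, mul_comm]

theorem norm_sq_eq_integral_sq (ξ : Lp ℝ 2 P) : ‖ξ‖ ^ 2 = ∫ ω, ξ ω ^ 2 ∂P := by
  rw [← real_inner_self_eq_norm_sq, inner_eq_integral_mul]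
  simp only [sq]

theorem coeFn_sum_smul {ι : Type*} [Fintype ι] (c : ι → ℝ) (ξ : ι → Lp ℝ 2 P) :
    ⇑(∑ i, c i • ξ i) =ᵐ[P] fun ω => ∑ i, c i * ξ i ω := by
  have hsmul : ∀ᵐ ω ∂P, ∀ i, (c i • ξ i) ω = c i * ξ i ω :=
    ae_all_iff.mpr fun i => Lp.coeFn_smul (c i) (ξ i)
  filter_upwards [Lp.coeFn_finsetSum Finset.univ fun i => c i • ξ i, hsmul] with ω hsum hsmul
  rw [hsum, Finset.sum_apply]
  exact Finset.sum_congr rfl fun i _ => hsmul i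

/-- A Gaussian linear space: a space of square integrable random variables all of which are
centred Gaussian. The variance is recorded as the square of the norm in `L²`. -/
def IsGaussianLinearSpace (A : Submodule ℝ (Lp ℝ 2 P)) : Prop :=
  ∀ ξ ∈ A, HasLaw ξ (gaussianReal 0 (‖ξ‖₊ ^ 2)) P

theorem hasLaw_of_hasGaussianLaw {ξ : Lp ℝ 2 P} (h : HasGaussianLaw ξ P)
    (hmean : ∫ ω, ξ ω ∂P = 0) : HasLaw ξ (gaussianReal 0 (‖ξ‖₊ ^ 2)) P where
  aemeasurable := aemeasurable_Lp ξ
  map_eq := by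
    rw [h.map_eq_gaussianReal, hmean, variance_of_integral_eq_zero (aemeasurable_Lp ξ) hmean,
      ← norm_sq_eq_integral_sq]
    congr 1
    ext
    simp

theorem integral_sq_of_hasLaw_gaussianReal {X : Ω → ℝ} {v : ℝ≥0}
    (h : HasLaw X (gaussianReal 0 v) P) : ∫ ω, X ω ^ 2 ∂P = v := by
  rw [← variance_of_integral_eq_zero h.aemeasurable
    (by rw [h.integral_eq, integral_id_gaussianReal]), h.variance_eq, variance_id_gaussianReal]

theorem norm_eq_one_of_hasLaw {ξ : Lp ℝ 2 P} (h : HasLaw ξ (gaussianReal 0 1) P) : ‖ξ‖ = 1 := by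
  rw [← pow_eq_one_iff_of_nonneg (norm_nonneg ξ) two_ne_zero, norm_sq_eq_integral_sq,
    integral_sq_of_hasLaw_gaussianReal h, NNReal.coe_one]

theorem orthonormal_of_iIndepFun {ι : Type*} {ξ : ι → Lp ℝ 2 P}
    (hlaw : ∀ i, HasLaw (ξ i) (gaussianReal 0 1) P) (hind : iIndepFun (fun i => (ξ i : Ω → ℝ)) P) :
    Orthonormal ℝ ξ := by
  refine ⟨fun i => norm_eq_one_of_hasLaw (hlaw i), fun i j hij => ?_⟩
  change inner ℝ (ξ i) (ξ j) = 0
  rw [inner_eq_integral_mul, (hind.indepFun hij).integral_fun_mul_eq_mul_integral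
    (Lp.aestronglyMeasurable _) (Lp.aestronglyMeasurable _), (hlaw i).integral_eq,
    integral_id_gaussianReal, zero_mul]

theorem charFun_gaussianReal_nnnorm_sq {E : Type*} [SeminormedAddGroup E] (ξ : E) (t : ℝ) :
    charFun (gaussianReal 0 (‖ξ‖₊ ^ 2)) t = Complex.exp (-(t ^ 2 * ‖ξ‖ ^ 2 / 2)) := by
  rw [charFun_gaussianReal]
  congr 1
  push_cast
  simp only [mul_zero, zero_sub, mul_comm]

theorem continuous_charFun_map_Lp [IsProbabilityMeasure P] (t : ℝ) :
    Continuous fun ξ : Lp ℝ 2 P => charFun (P.map ξ) t := by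
  refine continuous_iff_seqContinuous.mpr fun u ξ hu => ?_
  have hlaw := (tendstoInMeasure_of_tendsto_Lp hu).tendstoInDistribution
    fun k => aemeasurable_Lp (u k)
  exact ProbabilityMeasure.tendsto_iff_tendsto_charFun.mp hlaw.tendsto t

theorem isClosed_setOf_hasLaw_gaussianReal [IsProbabilityMeasure P] :
    IsClosed {ξ : Lp ℝ 2 P | HasLaw ξ (gaussianReal 0 (‖ξ‖₊ ^ 2)) P} := by
  have hiff (ξ : Lp ℝ 2 P) : HasLaw ξ (gaussianReal 0 (‖ξ‖₊ ^ 2)) P ↔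
      ∀ t : ℝ, charFun (P.map ξ) t = Complex.exp (-(t ^ 2 * ‖ξ‖ ^ 2 / 2)) := by
    have := Measure.isProbabilityMeasure_map (aemeasurable_Lp ξ)
    refine ⟨fun h t => by rw [h.map_eq, charFun_gaussianReal_nnnorm_sq],
      fun h => ⟨aemeasurable_Lp ξ, Measure.ext_of_charFun (funext fun t => ?_)⟩⟩
    rw [h, charFun_gaussianReal_nnnorm_sq]
  simp only [hiff, Set.ofPred_forall]
  exact isClosed_iInter fun t => isClosed_eq (continuous_charFun_map_Lp t) (by fun_prop)

namespace IsGaussianLinearSpace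

variable {A : Submodule ℝ (Lp ℝ 2 P)}

theorem topologicalClosure [IsProbabilityMeasure P] (hA : IsGaussianLinearSpace A) :
    IsGaussianLinearSpace A.topologicalClosure :=
  fun _ hξ => isClosed_setOf_hasLaw_gaussianReal.closure_subset_iff.mpr hA hξ

theorem hasLaw (hA : IsGaussianLinearSpace A) {ξ : Lp ℝ 2 P} (hξ : ξ ∈ A) (hnorm : ‖ξ‖ = 1) :
    HasLaw ξ (gaussianReal 0 1) P := by
  have hnn : ‖ξ‖₊ = 1 := NNReal.eq hnorm
  simpa [hnn] using hA ξ hξ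

theorem integral_eq_zero (hA : IsGaussianLinearSpace A) {ξ : Lp ℝ 2 P} (hξ : ξ ∈ A) :
    ∫ ω, ξ ω ∂P = 0 := by
  rw [(hA ξ hξ).integral_eq, integral_id_gaussianReal]

theorem integral_exp (hA : IsGaussianLinearSpace A) {ξ : Lp ℝ 2 P} (hξ : ξ ∈ A) (s : ℝ) :
    ∫ ω, Complex.exp (s * ξ ω * Complex.I) ∂P = Complex.exp (-(s ^ 2 * ‖ξ‖ ^ 2 / 2)) := by
  rw [← charFun_gaussianReal_nnnorm_sq, ← (hA ξ hξ).map_eq, charFun_apply_real,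
    integral_map (aemeasurable_Lp ξ) (by fun_prop)]

theorem hasGaussianLaw_pi (hA : IsGaussianLinearSpace A) {ι : Type*} [Finite ι]
    {ξ : ι → Lp ℝ 2 P} (hξ : ∀ i, ξ i ∈ A) : HasGaussianLaw (fun ω i => ξ i ω) P := by
  classical
  have := Fintype.ofFinite ι
  refine ⟨isGaussian_of_map_eq_gaussianReal fun L => ?_⟩
  let η : Lp ℝ 2 P := ∑ i, L (Pi.single i 1) • ξ i
  refine ⟨0, ‖η‖₊ ^ 2, ?_⟩
  have hη : η ∈ A := Submodule.sum_mem _ fun i _ => Submodule.smul_mem _ _ (hξ i)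
  rw [AEMeasurable.map_map_of_aemeasurable (by fun_prop)
    (aemeasurable_pi_lambda _ fun i => aemeasurable_Lp (ξ i)), ← (hA η hη).map_eq]
  refine Measure.map_congr ?_
  filter_upwards [coeFn_sum_smul (fun i => L (Pi.single i 1)) ξ] with ω hω
  rw [hω, Function.comp_apply, ← ContinuousLinearMap.coe_coe, LinearMap.pi_apply_eq_sum_univ]
  refine Finset.sum_congr rfl fun i _ => ?_
  rw [smul_eq_mul, mul_comm, ContinuousLinearMap.coe_coe]
  congr 2
  ext j
  simp [Pi.single_apply, eq_comm]

theorem iIndepFun_of_orthogonal (hA : IsGaussianLinearSpace A) {ι : Type*} [Finite ι]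
    {ξ : ι → Lp ℝ 2 P} (hξ : ∀ i, ξ i ∈ A) (horth : Pairwise fun i j => inner ℝ (ξ i) (ξ j) = 0) :
    iIndepFun (fun i => (ξ i : Ω → ℝ)) P := by
  have hgauss := hA.hasGaussianLaw_pi hξ
  have := hgauss.isProbabilityMeasure
  refine hgauss.iIndepFun_of_covariance_eq_zero fun i j hij => ?_
  rw [covariance_eq_sub (Lp.memLp _) (Lp.memLp _), hA.integral_eq_zero (hξ i), zero_mul, sub_zero]
  exact (inner_eq_integral_mul _ _).symm.trans (horth hij)

theorem iIndepFun_option (hA : IsGaussianLinearSpace A) {ι : Type*} [Finite ι] {W : Lp ℝ 2 P}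
    (hW : W ∈ A) {ξ : ι → Lp ℝ 2 P} (hξ : ∀ i, ξ i ∈ A) (hon : Orthonormal ℝ ξ)
    (hWξ : ∀ i, inner ℝ W (ξ i) = 0) :
    iIndepFun (fun i : Option ι => ((i.elim W ξ : Lp ℝ 2 P) : Ω → ℝ)) P := by
  refine hA.iIndepFun_of_orthogonal (ξ := fun i : Option ι => i.elim W ξ)
    (by rintro (_ | i); exacts [hW, hξ i]) ?_
  rintro (_ | i) (_ | j) hij
  · exact absurd rfl hij
  · exact hWξ j
  · exact (real_inner_comm _ _).trans (hWξ i)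
  · exact hon.2 fun h => hij (congrArg some h)

end IsGaussianLinearSpace

end GaussianLinearSpace

section Residual

variable {E : Type*} [NormedAddCommGroup E] [InnerProductSpace ℝ E] {ι : Type*} [Fintype ι]
  {v : ι → E}

theorem inner_sub_sum_inner_smul (hv : Orthonormal ℝ v) (x : E) (j : ι) :
    inner ℝ (x - ∑ i, inner ℝ (v i) x • v i) (v j) = 0 := by
  classical
  rw [inner_sub_left, hv.inner_left_fintype, real_inner_comm]
  simp

theorem norm_sub_sum_inner_smul_sq (hv : Orthonormal ℝ v) (x : E) :
    ‖x - ∑ i, inner ℝ (v i) x • v i‖ ^ 2 = ‖x‖ ^ 2 - ∑ i, inner ℝ (v i) x ^ 2 := by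
  rw [← real_inner_self_eq_norm_sq, inner_sub_right, inner_sum]
  simp only [real_inner_smul_right, inner_sub_sum_inner_smul hv, mul_zero, Finset.sum_const_zero,
    sub_zero]
  rw [inner_sub_left, sum_inner, real_inner_self_eq_norm_sq]
  simp only [real_inner_smul_left, sq]

end Residual

section CharFun

variable {Ω : Type*} [MeasurableSpace Ω] {P : Measure Ω}

theorem integrable_max_zero_smul {E : Type*} [NormedAddCommGroup E] [NormedSpace ℝ E] {D : Ω → ℝ}
    {f : Ω → E} (hD : AEMeasurable D P) (hf : AEStronglyMeasurable f P)
    (h : Integrable (fun ω => D ω • f ω) P) : Integrable (fun ω => max (D ω) 0 • f ω) P := by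
  refine h.mono ((hD.max aemeasurable_const).aestronglyMeasurable.smul hf)
    (Eventually.of_forall fun ω => ?_)
  rw [norm_smul, norm_smul]
  gcongr
  rw [Real.norm_of_nonneg (le_max_right _ _)]
  exact max_le (le_abs_self _) (abs_nonneg _)

theorem integral_withDensity_ofReal {E : Type*} [NormedAddCommGroup E] [NormedSpace ℝ E]
    {D : Ω → ℝ} (hD : AEMeasurable D P) (f : Ω → E) :
    ∫ ω, f ω ∂P.withDensity (fun ω => ENNReal.ofReal (D ω)) = ∫ ω, max (D ω) 0 • f ω ∂P := by
  rw [integral_withDensity_eq_integral_toReal_smul₀ hD.ennreal_ofReal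
    (Eventually.of_forall fun _ => ENNReal.ofReal_lt_top)]
  simp only [ENNReal.toReal_ofReal']

theorem integral_withDensity_ofReal_sub {E : Type*} [NormedAddCommGroup E] [NormedSpace ℝ E]
    {D : Ω → ℝ} {f : Ω → E} (hD : AEMeasurable D P) (hf : AEStronglyMeasurable f P)
    (h : Integrable (fun ω => D ω • f ω) P) :
    ∫ ω, f ω ∂P.withDensity (fun ω => ENNReal.ofReal (D ω)) -
      ∫ ω, f ω ∂P.withDensity (fun ω => ENNReal.ofReal (-D ω)) = ∫ ω, D ω • f ω ∂P := by
  have hneg : Integrable (fun ω => -D ω • f ω) P := by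
    simpa only [neg_smul] using! h.neg
  rw [integral_withDensity_ofReal hD, integral_withDensity_ofReal (D := fun ω => -D ω) hD.neg,
    ← integral_sub (integrable_max_zero_smul hD hf h)
      (integrable_max_zero_smul (D := fun ω => -D ω) hD.neg hf hneg)]
  simp only [← sub_smul, max_zero_sub_max_neg_zero_eq_self]

theorem integrable_exp_mul {T : Ω → ℝ} (hT : AEMeasurable T P) {D : Ω → ℝ} (hD : Integrable D P)
    (s : ℝ) : Integrable (fun ω => Complex.exp (s * T ω * Complex.I) * D ω) P := by
  have hexp : Continuous fun x : ℝ => Complex.exp (s * x * Complex.I) := by fun_prop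
  refine hD.ofReal.bdd_mul (c := 1) (hexp.comp_aestronglyMeasurable hT.aestronglyMeasurable)
    (Eventually.of_forall fun ω => ?_)
  rw [← Complex.ofReal_mul, Complex.norm_exp_ofReal_mul_I]

theorem integral_comp_mul_eq_zero_of_charFun {T D : Ω → ℝ} (hT : AEMeasurable T P)
    (hD : Integrable D P) (h : ∀ s : ℝ, ∫ ω, Complex.exp (s * T ω * Complex.I) * D ω ∂P = 0)
    {ψ : ℝ → ℝ} (hψ : Measurable ψ) (hψD : Integrable (fun ω => ψ (T ω) * D ω) P) :
    ∫ ω, ψ (T ω) * D ω ∂P = 0 := by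
  let ν (D : Ω → ℝ) : Measure Ω := P.withDensity fun ω => ENNReal.ofReal (D ω)
  have hDm : AEMeasurable D P := hD.aestronglyMeasurable.aemeasurable
  have : IsFiniteMeasure (ν D) := isFiniteMeasure_withDensity_ofReal hD.2
  have : IsFiniteMeasure (ν (-D)) := isFiniteMeasure_withDensity_ofReal hD.neg.2
  have hTν (D : Ω → ℝ) : AEMeasurable T (ν D) := hT.mono_ac (withDensity_absolutelyContinuous _ _)
  have hmap : (ν D).map T = (ν (-D)).map T := by
    refine Measure.ext_of_charFun (funext fun s => ?_)
    have hexp : Continuous fun x : ℝ => Complex.exp (s * x * Complex.I) := by fun_prop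
    have h_int := integrable_exp_mul hT hD s
    simp only [mul_comm _ (D _ : ℂ), ← Complex.real_smul] at h_int h
    rw [charFun_apply_real, charFun_apply_real, integral_map (hTν _) (by fun_prop),
      integral_map (hTν _) (by fun_prop), ← sub_eq_zero, ← h s]
    exact integral_withDensity_ofReal_sub hDm
      (hexp.comp_aestronglyMeasurable hT.aestronglyMeasurable) h_int
  simp only [mul_comm (ψ _), ← smul_eq_mul] at hψD ⊢
  rw [← integral_withDensity_ofReal_sub (f := fun ω => ψ (T ω)) hDm
    (hψ.comp_aemeasurable hT).aestronglyMeasurable hψD, sub_eq_zero]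
  have hψint := congrArg (fun μ => ∫ x, ψ x ∂μ) hmap
  simp only [integral_map (hTν _) hψ.aestronglyMeasurable] at hψint
  exact hψint

end CharFun

section HermiteProducts

variable {Ω : Type*} [MeasurableSpace Ω] {P : Measure Ω} {A : Submodule ℝ (Lp ℝ 2 P)}

theorem integral_exp_mul_hermiteFun_of_hasLaw {X : Ω → ℝ} (hX : HasLaw X (gaussianReal 0 1) P)
    (s : ℝ) (p : ℕ) : ∫ ω, Complex.exp (s * X ω * Complex.I) * hermiteFun p (X ω) ∂P =
      (s * Complex.I) ^ p * Complex.exp (-s ^ 2 / 2) := by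
  rw [← integral_exp_mul_hermiteFun]
  exact hX.integral_comp (f := fun x : ℝ => Complex.exp (s * x * Complex.I) * hermiteFun p x)
    (by fun_prop)

theorem exp_mul_prod_hermiteFun {ι : Type*} [Fintype ι] (p : ι → ℕ) (s t : ℝ) (ρ x : ι → ℝ) :
    Complex.exp (s * t * Complex.I) * (∏ i, hermiteFun (p i) (x i) : ℝ) =
      Complex.exp (s * (t - ∑ i, ρ i * x i : ℝ) * Complex.I) *
        ∏ i, Complex.exp ((s * ρ i : ℝ) * x i * Complex.I) * hermiteFun (p i) (x i) := by
  have hsum : ∑ i, ((s * ρ i : ℝ) * x i * Complex.I : ℂ) =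
      s * (∑ i, ρ i * x i : ℝ) * Complex.I := by
    push_cast
    simp only [Finset.mul_sum, Finset.sum_mul, mul_assoc]
  rw [Finset.prod_mul_distrib, ← mul_assoc, ← Complex.exp_sum, ← Complex.exp_add, hsum,
    Complex.ofReal_prod]
  congr 2
  push_cast
  ring

namespace IsGaussianLinearSpace

theorem integral_comp_mul_prod_comp (hA : IsGaussianLinearSpace A) {ι : Type*} [Fintype ι]
    {W : Lp ℝ 2 P} (hW : W ∈ A) {ξ : ι → Lp ℝ 2 P} (hξ : ∀ i, ξ i ∈ A) (hon : Orthonormal ℝ ξ)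
    (hWξ : ∀ i, inner ℝ W (ξ i) = 0) {g : ℝ → ℂ} (hg : Continuous g) {f : ι → ℝ → ℂ}
    (hf : ∀ i, Continuous (f i)) :
    ∫ ω, g (W ω) * ∏ i, f i (ξ i ω) ∂P = (∫ ω, g (W ω) ∂P) * ∏ i, ∫ ω, f i (ξ i ω) ∂P := by
  have h := (hA.iIndepFun_option hW hξ hon hWξ).integral_fun_prod_comp
    (f := fun i : Option ι => i.elim g f) (fun i => aemeasurable_Lp _)
    (by rintro (_ | i); exacts [hg.aestronglyMeasurable, (hf i).aestronglyMeasurable])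
  simpa only [Fintype.prod_option, Option.elim] using h

theorem integral_exp_mul_prod_hermiteFun (hA : IsGaussianLinearSpace A) {T : Lp ℝ 2 P}
    (hT : T ∈ A) {ι : Type*} [Fintype ι] (p : ι → ℕ) {ξ : ι → Lp ℝ 2 P} (hξ : ∀ i, ξ i ∈ A)
    (hon : Orthonormal ℝ ξ) (s : ℝ) :
    ∫ ω, Complex.exp (s * T ω * Complex.I) * (∏ i, hermiteFun (p i) (ξ i ω) : ℝ) ∂P
      = (∏ i, inner ℝ (ξ i) T ^ p i : ℝ) * ((s * Complex.I) ^ (∑ i, p i) *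
        Complex.exp (-(s ^ 2 * ‖T‖ ^ 2 / 2))) := by
  let ρ (i : ι) : ℝ := inner ℝ (ξ i) T
  let W : Lp ℝ 2 P := T - ∑ i, ρ i • ξ i
  have hW : W ∈ A :=
    Submodule.sub_mem _ hT (Submodule.sum_mem _ fun i _ => Submodule.smul_mem _ _ (hξ i))
  have hWnorm : (‖W‖ : ℂ) ^ 2 = (‖T‖ : ℂ) ^ 2 - ∑ i, (ρ i : ℂ) ^ 2 := by
    exact_mod_cast norm_sub_sum_inner_smul_sq hon T
  have hfactor : ∀ᵐ ω ∂P, Complex.exp (s * T ω * Complex.I) *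
      (∏ i, hermiteFun (p i) (ξ i ω) : ℝ) = Complex.exp (s * W ω * Complex.I) *
        ∏ i, Complex.exp ((s * ρ i : ℝ) * ξ i ω * Complex.I) * hermiteFun (p i) (ξ i ω) := by
    filter_upwards [Lp.coeFn_sub T (∑ i, ρ i • ξ i), coeFn_sum_smul ρ ξ] with ω hsub hsum
    rw [hsub, Pi.sub_apply, hsum]
    exact exp_mul_prod_hermiteFun p s (T ω) ρ fun i => ξ i ω
  rw [integral_congr_ae hfactor, hA.integral_comp_mul_prod_comp hW hξ hon
    (inner_sub_sum_inner_smul hon T) (g := fun x => Complex.exp (s * x * Complex.I))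
    (f := fun i x => Complex.exp ((s * ρ i : ℝ) * x * Complex.I) * hermiteFun (p i) x)
    (by fun_prop) (fun i => by fun_prop), hA.integral_exp hW]
  simp only [integral_exp_mul_hermiteFun_of_hasLaw (hA.hasLaw (hξ _) (hon.1 _))]
  have hexp : Complex.exp (-(s ^ 2 * ‖W‖ ^ 2 / 2)) * ∏ i, Complex.exp (-((s * ρ i : ℝ) : ℂ) ^ 2 / 2)
      = Complex.exp (-(s ^ 2 * ‖T‖ ^ 2 / 2)) := by
    rw [← Complex.exp_sum, ← Complex.exp_add, hWnorm]
    push_cast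
    simp only [mul_pow, neg_div, Finset.sum_neg_distrib, ← Finset.sum_div, ← Finset.mul_sum]
    ring_nf
  rw [Finset.prod_mul_distrib, mul_left_comm, hexp, ← Finset.prod_pow_eq_pow_sum, ← mul_assoc,
    Complex.ofReal_prod, ← Finset.prod_mul_distrib]
  refine congrArg (· * _) (Finset.prod_congr rfl fun i _ => ?_)
  push_cast
  ring

theorem integral_comp_mul_prod_hermiteFun (hA : IsGaussianLinearSpace A) {T : Lp ℝ 2 P}
    (hT : T ∈ A) (hnorm : ‖T‖ = 1) {ι : Type*} [Fintype ι] (p : ι → ℕ) {ξ : ι → Lp ℝ 2 P}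
    (hξ : ∀ i, ξ i ∈ A) (hon : Orthonormal ℝ ξ) {F : Ω → ℝ} (hF : Integrable F P)
    (hFeq : ∀ᵐ ω ∂P, F ω = ∏ i, hermiteFun (p i) (ξ i ω)) {ψ : ℝ → ℝ} (hψ : Measurable ψ)
    (hψF : Integrable (fun ω => ψ (T ω) * F ω) P)
    (hψH : Integrable (fun x => ψ x * hermiteFun (∑ i, p i) x) (gaussianReal 0 1)) :
    ∫ ω, ψ (T ω) * F ω ∂P = (∏ i, inner ℝ (ξ i) T ^ p i) *
      ∫ x, ψ x * hermiteFun (∑ i, p i) x ∂gaussianReal 0 1 := by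
  set c : ℝ := ∏ i, inner ℝ (ξ i) T ^ p i
  set q := ∑ i, p i
  have hTlaw : HasLaw T (gaussianReal 0 1) P := hA.hasLaw hT hnorm
  have hcomp {g : ℝ → ℝ} (hg : Integrable g (gaussianReal 0 1)) :
      Integrable (fun ω => g (T ω)) P := by
    rw [← hTlaw.map_eq] at hg
    exact hg.comp_aemeasurable hTlaw.aemeasurable
  have hH : Integrable (fun ω => hermiteFun q (T ω)) P := hcomp (integrable_aeval_gaussianReal _)
  have hcharFun (s : ℝ) : ∫ ω, Complex.exp (s * T ω * Complex.I) *
      ((F ω - c * hermiteFun q (T ω) : ℝ) : ℂ) ∂P = 0 := by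
    have hF' : ∫ ω, Complex.exp (s * T ω * Complex.I) * F ω ∂P =
        c * ((s * Complex.I) ^ q * Complex.exp (-s ^ 2 / 2)) := by
      rw [integral_congr_ae (by filter_upwards [hFeq] with ω hω using by rw [hω]),
        hA.integral_exp_mul_prod_hermiteFun hT p hξ hon s, hnorm]
      simp [neg_div, c, q]
    simp only [Complex.ofReal_sub, Complex.ofReal_mul, mul_sub, mul_left_comm _ (c : ℂ)]
    rw [integral_sub (integrable_exp_mul hTlaw.aemeasurable hF s)
      ((integrable_exp_mul hTlaw.aemeasurable hH s).const_mul _), integral_const_mul, hF',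
      integral_exp_mul_hermiteFun_of_hasLaw hTlaw, sub_self]
  have hzero := integral_comp_mul_eq_zero_of_charFun hTlaw.aemeasurable (hF.sub (hH.const_mul c))
    hcharFun hψ
  simp only [Pi.sub_apply, mul_sub, mul_left_comm _ c] at hzero
  have hψH' := (hcomp hψH).const_mul c
  specialize hzero (hψF.sub hψH')
  rw [integral_sub hψF hψH', integral_const_mul, sub_eq_zero] at hzero
  exact hzero.trans (congrArg (c * ·)
    (hTlaw.integral_comp (f := fun x => ψ x * hermiteFun q x) hψH.aestronglyMeasurable))

end IsGaussianLinearSpace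

end HermiteProducts

/-! ### The Gaussian space of the coefficients -/

section Coefficients

variable {Ω : Type*} [MeasurableSpace Ω] {a : (Fin 2 → ℤ) → Ω → ℂ} {P : Measure Ω}
  {l m : Fin 2 → ℤ}

theorem ne_zero_of_mem_halfLattice (h : l ∈ halfLattice) : l ≠ 0 := by
  rintro rfl
  simp [halfLattice] at h

theorem mem_or_neg_mem_halfLattice (h : l ≠ 0) : l ∈ halfLattice ∨ -l ∈ halfLattice := by
  simp only [halfLattice, Set.mem_ofPred_eq, Pi.neg_apply]
  by_contra! hcon
  have hl : l 0 = 0 ∧ l 1 = 0 := by omega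
  exact h (funext (Fin.forall_fin_two.mpr hl))

theorem exists_halfLattice_re_mul_eq (ha : IsGaussianCoefficients a P) (hl : l ≠ 0) (z : ℂ) :
    ∃ (k : halfLattice) (w : ℂ), ((k : Fin 2 → ℤ) = l ∨ (k : Fin 2 → ℤ) = -l) ∧
      (fun ω => (z * a l ω).re) =ᵐ[P] fun ω => (w * a k ω).re := by
  rcases mem_or_neg_mem_halfLattice hl with h | h
  · exact ⟨⟨l, h⟩, z, Or.inl rfl, EventuallyEq.rfl⟩
  · refine ⟨⟨-l, h⟩, conj z, Or.inr rfl, ?_⟩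
    filter_upwards [ha.conj_eq l hl] with ω hω
    rw [← hω, ← map_mul, Complex.conj_re]

theorem mul_add_conj_mul_eq (ha : IsGaussianCoefficients a P) (hl : l ≠ 0) (z : ℂ) :
    ∀ᵐ ω ∂P, z * a l ω + conj z * a (-l) ω = ((2 * z * a l ω).re : ℂ) := by
  filter_upwards [ha.conj_eq l hl] with ω hω
  rw [← hω, ← map_mul, Complex.add_conj, mul_assoc, ← Complex.ofReal_ofNat 2, Complex.re_ofReal_mul]

theorem exists_finsupp_of_mem_span (ha : IsGaussianCoefficients a P) {ξ : Lp ℝ 2 P}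
    (hξ : ξ ∈ Submodule.span ℝ {ξ : Lp ℝ 2 P | ∃ (l : Fin 2 → ℤ) (z : ℂ), l ≠ 0 ∧
      ∀ᵐ ω ∂P, ((ξ ω : ℝ) : ℂ) = z * a l ω + conj z * a (-l) ω}) :
    ∃ c : halfLattice →₀ ℂ, ξ =ᵐ[P] fun ω => c.sum fun l z => (z * a l ω).re := by
  induction hξ using Submodule.span_induction with
  | mem ξ h =>
    obtain ⟨l, z, hl, hξ⟩ := h
    obtain ⟨k, w, -, hw⟩ := exists_halfLattice_re_mul_eq ha hl (2 * z)
    refine ⟨Finsupp.single k w, ?_⟩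
    filter_upwards [hξ, mul_add_conj_mul_eq ha hl z, hw] with ω hξ hre hw
    rw [Finsupp.sum_single_index (by simp), ← hw]
    exact_mod_cast hξ.trans hre
  | zero =>
    refine ⟨0, ?_⟩
    filter_upwards [Lp.coeFn_zero ℝ 2 P] with ω hω
    rw [Finsupp.sum_zero_index]
    exact hω
  | add ξ η _ _ hξ hη =>
    obtain ⟨c, hc⟩ := hξ
    obtain ⟨d, hd⟩ := hη
    refine ⟨c + d, ?_⟩
    filter_upwards [Lp.coeFn_add ξ η, hc, hd] with ω hadd hξ hη
    rw [Finsupp.sum_add_index' (by simp) (by intros; simp [add_mul]), hadd, Pi.add_apply, hξ, hη]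
  | smul r ξ _ hξ =>
    obtain ⟨c, hc⟩ := hξ
    refine ⟨r • c, ?_⟩
    filter_upwards [Lp.coeFn_smul r ξ, hc] with ω hsmul hξ
    rw [Finsupp.sum_smul_index' (by simp), hsmul, Pi.smul_apply, hξ, Finsupp.smul_sum]
    simp only [smul_mul_assoc, Complex.smul_re]

theorem integral_re_mul_mul_re_mul_self (ha : IsGaussianCoefficients a P) (hl : l ≠ 0) (z w : ℂ) :
    ∫ ω, (z * a l ω).re * (w * a l ω).re ∂P = (z * conj w).re / 2 := by
  have hre : HasGaussianLaw (fun ω => (a l ω).re) P := (ha.hasLaw_re l hl).hasGaussianLaw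
  have him : HasGaussianLaw (fun ω => (a l ω).im) P := (ha.hasLaw_im l hl).hasGaussianLaw
  have h_int : Integrable (fun ω => (a l ω).re * (a l ω).im) P :=
    hre.memLp_two.integrable_mul him.memLp_two
  have hcross : ∫ ω, (a l ω).re * (a l ω).im ∂P = 0 := by
    rw [(ha.indep_re_im l hl).integral_fun_mul_eq_mul_integral
      hre.aemeasurable.aestronglyMeasurable him.aemeasurable.aestronglyMeasurable,
      (ha.hasLaw_re l hl).integral_eq, integral_id_gaussianReal, zero_mul]
  have hexpand (ω : Ω) : (z * a l ω).re * (w * a l ω).re =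
      z.re * w.re * (a l ω).re ^ 2 + z.im * w.im * (a l ω).im ^ 2 -
        (z.re * w.im + z.im * w.re) * ((a l ω).re * (a l ω).im) := by
    simp only [Complex.mul_re]
    ring
  have hre_sq := hre.memLp_two.integrable_sq.const_mul (z.re * w.re)
  have him_sq := him.memLp_two.integrable_sq.const_mul (z.im * w.im)
  simp only [hexpand]
  rw [integral_sub (hre_sq.fun_add him_sq) (h_int.const_mul _), integral_add hre_sq him_sq,
    integral_const_mul, integral_const_mul, integral_const_mul, hcross,
    integral_sq_of_hasLaw_gaussianReal (ha.hasLaw_re l hl),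
    integral_sq_of_hasLaw_gaussianReal (ha.hasLaw_im l hl)]
  simp only [Complex.mul_re, Complex.conj_re, Complex.conj_im]
  push_cast
  ring

theorem integral_re_mul_mul_re_mul_neg (ha : IsGaussianCoefficients a P) (hl : l ≠ 0) (z w : ℂ) :
    ∫ ω, (z * a l ω).re * (w * a (-l) ω).re ∂P = (z * w).re / 2 := by
  rw [← Complex.conj_conj w, ← integral_re_mul_mul_re_mul_self ha hl z]
  refine integral_congr_ae ?_
  filter_upwards [ha.conj_eq l hl] with ω hω
  rw [← hω, ← map_mul, Complex.conj_re]

theorem hasGaussianLaw_re_mul (ha : IsGaussianCoefficients a P) (hl : l ≠ 0) (z : ℂ) :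
    HasGaussianLaw (fun ω => (z * a l ω).re) P := by
  have hre : HasGaussianLaw (fun ω => (a l ω).re) P := (ha.hasLaw_re l hl).hasGaussianLaw
  have him : HasGaussianLaw (fun ω => (a l ω).im) P := (ha.hasLaw_im l hl).hasGaussianLaw
  have hind : IndepFun (fun ω => z.re • (a l ω).re) (fun ω => z.im • (a l ω).im) P :=
    (ha.indep_re_im l hl).comp (φ := fun x => z.re • x) (ψ := fun x => z.im • x)
      (by fun_prop) (by fun_prop)
  simpa only [Complex.mul_re] using!
    iIndepFun.hasGaussianLaw_fun_sub (hre.fun_smul z.re) (him.fun_smul z.im) hind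

theorem integral_re_mul (ha : IsGaussianCoefficients a P) (hl : l ≠ 0) (z : ℂ) :
    ∫ ω, (z * a l ω).re ∂P = 0 := by
  have hre : HasGaussianLaw (fun ω => (a l ω).re) P := (ha.hasLaw_re l hl).hasGaussianLaw
  have him : HasGaussianLaw (fun ω => (a l ω).im) P := (ha.hasLaw_im l hl).hasGaussianLaw
  simp only [Complex.mul_re]
  rw [integral_sub (hre.integrable.const_mul _) (him.integrable.const_mul _), integral_const_mul,
    integral_const_mul, (ha.hasLaw_re l hl).integral_eq, (ha.hasLaw_im l hl).integral_eq,
    integral_id_gaussianReal, mul_zero, mul_zero, sub_zero]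

theorem integral_re_mul_mul_re_mul_of_ne (ha : IsGaussianCoefficients a P) (hl : l ≠ 0)
    (hm : m ≠ 0) (hne : l ≠ m) (hneg : l ≠ -m) (z w : ℂ) :
    ∫ ω, (z * a l ω).re * (w * a m ω).re ∂P = 0 := by
  obtain ⟨k, z', hk, hz⟩ := exists_halfLattice_re_mul_eq ha hl z
  obtain ⟨j, w', hj, hw⟩ := exists_halfLattice_re_mul_eq ha hm w
  have hkj : k ≠ j := by
    rintro rfl
    rcases hk with hk | hk <;> rcases hj with hj | hj <;> rw [hk] at hj
    exacts [hne hj, hneg hj, hneg (neg_eq_iff_eq_neg.mp hj), hne (neg_injective hj)]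
  have hind : IndepFun (fun ω => (z' * a k ω).re) (fun ω => (w' * a j ω).re) P :=
    (ha.iIndep.indepFun hkj).comp (φ := fun u => (z' * u).re) (ψ := fun u => (w' * u).re)
      (by fun_prop) (by fun_prop)
  have hmeas (k : halfLattice) (z : ℂ) : AEStronglyMeasurable (fun ω => (z * a k ω).re) P :=
    (hasGaussianLaw_re_mul ha (ne_zero_of_mem_halfLattice k.2) z).aemeasurable.aestronglyMeasurable
  rw [integral_congr_ae (hz.fun_mul hw),
    hind.integral_fun_mul_eq_mul_integral (hmeas k z') (hmeas j w'),
    integral_re_mul ha (ne_zero_of_mem_halfLattice k.2), zero_mul]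

theorem hasGaussianLaw_finsupp_sum (ha : IsGaussianCoefficients a P) (c : halfLattice →₀ ℂ) :
    HasGaussianLaw (fun ω => c.sum fun l z => (z * a l ω).re) P := by
  have hind : iIndepFun (fun (l : c.support) ω => (c l * a l ω).re) P :=
    (ha.iIndep.precomp (g := fun l : c.support => (l : halfLattice)) Subtype.val_injective).comp
      (fun l x => (c l * x).re) fun l => by fun_prop
  simpa only [Finsupp.sum, ← Finset.sum_coe_sort c.support] using
    iIndepFun.hasGaussianLaw_fun_sum (fun l : c.support =>
      hasGaussianLaw_re_mul ha (ne_zero_of_mem_halfLattice l.1.2) (c l)) hind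

theorem integral_finsupp_sum (ha : IsGaussianCoefficients a P) (c : halfLattice →₀ ℂ) :
    ∫ ω, c.sum (fun l z => (z * a l ω).re) ∂P = 0 := by
  simp only [Finsupp.sum]
  rw [integral_finsetSum _ fun l _ =>
    (hasGaussianLaw_re_mul ha (ne_zero_of_mem_halfLattice l.2) (c l)).integrable]
  exact Finset.sum_eq_zero fun l _ => integral_re_mul ha (ne_zero_of_mem_halfLattice l.2) (c l)

theorem exists_mem_gaussianSpace_re_mul (ha : IsGaussianCoefficients a P) (hl : l ≠ 0) (z : ℂ) :
    ∃ ξ ∈ gaussianSpace a P, ξ =ᵐ[P] fun ω => (z * a l ω).re := by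
  have hmem := (hasGaussianLaw_re_mul ha hl z).memLp_two
  refine ⟨hmem.toLp _, Submodule.le_topologicalClosure _
    (Submodule.subset_span ⟨l, z / 2, hl, ?_⟩), hmem.coeFn_toLp⟩
  filter_upwards [hmem.coeFn_toLp, mul_add_conj_mul_eq ha hl (z / 2)] with ω htoLp hre
  rw [htoLp, hre, mul_div_cancel₀ z two_ne_zero]

theorem isGaussianLinearSpace_gaussianSpace [IsProbabilityMeasure P]
    (ha : IsGaussianCoefficients a P) :
    IsGaussianLinearSpace (gaussianSpace a P) := by
  refine IsGaussianLinearSpace.topologicalClosure fun ξ hξ => ?_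
  obtain ⟨c, hc⟩ := exists_finsupp_of_mem_span ha hξ
  refine hasLaw_of_hasGaussianLaw ((hasGaussianLaw_finsupp_sum ha c).congr hc.symm) ?_
  rw [integral_congr_ae hc, integral_finsupp_sum ha]

end Coefficients

/-! ### The wave -/

section Wave

variable {Ω : Type*}

theorem wave_eq_sum (a : (Fin 2 → ℤ) → Ω → ℂ) (n : ℕ) (x : Torus) (ω : Ω) :
    wave a n x ω = (√(latticeCount n))⁻¹ * ∑ l ∈ latticePoints n, (mFourier l x * a l ω).re := by
  rw [wave, ← Complex.ofReal_inv, Complex.re_ofReal_mul, Complex.re_sum]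
  simp only [mul_comm (a _ ω)]

variable [MeasurableSpace Ω] {a : (Fin 2 → ℤ) → Ω → ℂ} {P : Measure Ω} {n : ℕ}

theorem measurable_uncurry_wave (ha : IsGaussianCoefficients a P) (hn : 0 < n) :
    Measurable fun z : Torus × Ω => wave a n z.1 z.2 := by
  simp only [wave_eq_sum]
  refine (Finset.measurable_sum _ fun l hl => ?_).const_mul _
  have hal := ha.measurable l (ne_zero_of_mem_latticePoints hn hl)
  exact Complex.measurable_re.comp
    (((mFourier l).continuous.measurable.comp measurable_fst).mul (hal.comp measurable_snd))

theorem exists_mem_gaussianSpace_wave (ha : IsGaussianCoefficients a P) (hn : 0 < n) (x : Torus) :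
    ∃ ξ ∈ gaussianSpace a P, ξ =ᵐ[P] wave a n x := by
  choose! ξ hξ hre using fun l (hl : l ∈ latticePoints n) =>
    exists_mem_gaussianSpace_re_mul ha (ne_zero_of_mem_latticePoints hn hl) (mFourier l x)
  refine ⟨(√(latticeCount n))⁻¹ • ∑ l ∈ latticePoints n, ξ l,
    Submodule.smul_mem _ _ (Submodule.sum_mem _ hξ), ?_⟩
  have hre' : ∀ᵐ ω ∂P, ∀ l ∈ latticePoints n, ξ l ω = (mFourier l x * a l ω).re :=
    (ae_ball_iff (latticePoints n).countable_toSet).mpr hre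
  filter_upwards [Lp.coeFn_smul (√(latticeCount n))⁻¹ (∑ l ∈ latticePoints n, ξ l),
    Lp.coeFn_finsetSum (latticePoints n) ξ, hre'] with ω hsmul hsum hre
  rw [hsmul, Pi.smul_apply, hsum, Finset.sum_apply, Finset.sum_congr rfl hre, wave_eq_sum,
    smul_eq_mul]

theorem memLp_wave (ha : IsGaussianCoefficients a P) (hn : 0 < n) (x : Torus) :
    MemLp (wave a n x) 2 P :=
  have ⟨ξ, _, hξ⟩ := exists_mem_gaussianSpace_wave ha hn x
  (Lp.memLp ξ).ae_eq hξ

/-- The value of the wave at a point, as an element of `L²(P)`. -/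
def waveLp (ha : IsGaussianCoefficients a P) (hn : 0 < n) (x : Torus) : Lp ℝ 2 P :=
  (memLp_wave ha hn x).toLp _

theorem coeFn_waveLp (ha : IsGaussianCoefficients a P) (hn : 0 < n) (x : Torus) :
    waveLp ha hn x =ᵐ[P] wave a n x :=
  MemLp.coeFn_toLp _

theorem waveLp_mem_gaussianSpace (ha : IsGaussianCoefficients a P) (hn : 0 < n) (x : Torus) :
    waveLp ha hn x ∈ gaussianSpace a P := by
  obtain ⟨ξ, hmem, hξ⟩ := exists_mem_gaussianSpace_wave ha hn x
  rwa [Lp.ext ((coeFn_waveLp ha hn x).trans hξ.symm)]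

theorem sum_integral_re_mul_mul_re_mul (ha : IsGaussianCoefficients a P) (hn : 0 < n)
    {l : Fin 2 → ℤ} (hl : l ∈ latticePoints n) (z : ℂ) (w : (Fin 2 → ℤ) → ℂ) :
    ∑ m ∈ latticePoints n, ∫ ω, (z * a l ω).re * (w m * a m ω).re ∂P =
      (z * conj (w l)).re / 2 + (z * w (-l)).re / 2 := by
  have hl0 := ne_zero_of_mem_latticePoints hn hl
  rw [Finset.sum_eq_add_of_mem l (-l) hl (neg_mem_latticePoints hl) (self_ne_neg.mpr hl0),
    integral_re_mul_mul_re_mul_self ha hl0, integral_re_mul_mul_re_mul_neg ha hl0]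
  rintro m hm ⟨hml, hml'⟩
  exact integral_re_mul_mul_re_mul_of_ne ha hl0 (ne_zero_of_mem_latticePoints hn hm) hml.symm
    (fun h => hml' (neg_eq_iff_eq_neg.mp h.symm)) _ _

theorem inner_waveLp (ha : IsGaussianCoefficients a P) (hn : 0 < n) (x y : Torus) :
    inner ℝ (waveLp ha hn x) (waveLp ha hn y) = waveCov n (x - y) := by
  have hprod : ∀ᵐ ω ∂P, waveLp ha hn x ω * waveLp ha hn y ω = (latticeCount n : ℝ)⁻¹ *
      ∑ l ∈ latticePoints n, ∑ m ∈ latticePoints n,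
        (mFourier l x * a l ω).re * (mFourier m y * a m ω).re := by
    filter_upwards [coeFn_waveLp ha hn x, coeFn_waveLp ha hn y] with ω hx hy
    rw [hx, hy, wave_eq_sum, wave_eq_sum, mul_mul_mul_comm, Finset.sum_mul_sum, ← mul_inv,
      Real.mul_self_sqrt (Nat.cast_nonneg _)]
  have hmem {l : Fin 2 → ℤ} (hl : l ∈ latticePoints n) (z : ℂ) :
      MemLp (fun ω => (z * a l ω).re) 2 P :=
    (hasGaussianLaw_re_mul ha (ne_zero_of_mem_latticePoints hn hl) z).memLp_two
  have h_int {l m : Fin 2 → ℤ} (hl : l ∈ latticePoints n) (hm : m ∈ latticePoints n) (z w : ℂ) :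
      Integrable (fun ω => (z * a l ω).re * (w * a m ω).re) P :=
    (hmem hl z).integrable_mul (hmem hm w)
  rw [inner_eq_integral_mul, integral_congr_ae hprod, integral_const_mul, waveCov,
    integral_finsetSum _ fun l hl => integrable_finsetSum _ fun m hm => h_int hl hm _ _]
  refine congrArg _ (Finset.sum_congr rfl fun l hl => ?_)
  rw [integral_finsetSum _ fun m hm => h_int hl hm _ _]
  refine (sum_integral_re_mul_mul_re_mul ha hn hl _ _).trans ?_
  rw [mFourier_neg, add_halves, sub_eq_add_neg, mFourier_apply_add, mFourier_apply_neg]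

theorem norm_waveLp (ha : IsGaussianCoefficients a P) (hn : 0 < n) (hS : n ∈ sumsOfTwoSquares)
    (x : Torus) : ‖waveLp ha hn x‖ = 1 := by
  rw [← pow_eq_one_iff_of_nonneg (norm_nonneg _) two_ne_zero, ← real_inner_self_eq_norm_sq,
    inner_waveLp, sub_self, waveCov_zero hS]

theorem hasLaw_waveLp [IsProbabilityMeasure P] (ha : IsGaussianCoefficients a P) (hn : 0 < n)
    (hS : n ∈ sumsOfTwoSquares) (x : Torus) : HasLaw (waveLp ha hn x) (gaussianReal 0 1) P :=
  (isGaussianLinearSpace_gaussianSpace ha).hasLaw (waveLp_mem_gaussianSpace ha hn x)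
    (norm_waveLp ha hn hS x)

end Wave

/-! ### Small balls for Gaussian pairs -/

theorem integral_deltaApprox {ε : ℝ} (hε : 0 < ε) : ∫ x, deltaApprox ε x = 1 := by
  have h := integral_deltaApprox_mul hε fun _ => 1
  simp only [mul_one, intervalIntegral.integral_const, smul_eq_mul] at h
  rw [h, sub_neg_eq_add, ← two_mul, inv_mul_cancel₀ (by positivity)]

theorem integrable_deltaApprox (ε : ℝ) : Integrable (deltaApprox ε) :=
  (integrableOn_const (by simp)).integrable_indicator measurableSet_Ioo

theorem deltaApprox_eq_zero {ε x : ℝ} (h : ε ≤ |x|) : deltaApprox ε x = 0 :=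
  Set.indicator_of_notMem (fun hx => (abs_lt.mpr (Set.mem_Ioo.mp hx)).not_ge h) _

theorem integrable_deltaApprox_comp {α : Type*} [MeasurableSpace α] {μ : Measure α}
    [IsFiniteMeasure μ] (ε : ℝ) {f : α → ℝ} (hf : AEMeasurable f μ) :
    Integrable (fun x => deltaApprox ε (f x)) μ :=
  Integrable.of_bound ((measurable_deltaApprox ε).comp_aemeasurable hf).aestronglyMeasurable
    |(2 * ε)⁻¹| (Eventually.of_forall fun _ => norm_deltaApprox_le _ _)

theorem integral_deltaApprox_add_eq {v : ℝ≥0} (hv : v ≠ 0) (m δ : ℝ) :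
    ∫ w, deltaApprox δ (m + w) ∂gaussianReal 0 v =
      ∫ y, gaussianPDFReal 0 v (y - m) * deltaApprox δ y := by
  rw [integral_gaussianReal_eq_integral_smul hv,
    ← integral_add_left_eq_self (fun y => gaussianPDFReal 0 v (y - m) * deltaApprox δ y) m]
  simp only [smul_eq_mul, add_sub_cancel_left]

theorem integrable_gaussianPDFReal_mul_deltaApprox (v : ℝ≥0) (m δ : ℝ) :
    Integrable fun y => gaussianPDFReal 0 v (y - m) * deltaApprox δ y :=
  ((integrable_gaussianPDFReal 0 v).comp_sub_right m).mul_bdd (c := |(2 * δ)⁻¹|)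
    (measurable_deltaApprox δ).aestronglyMeasurable
    (Eventually.of_forall fun _ => norm_deltaApprox_le _ _)

theorem integral_deltaApprox_add_le {v : ℝ≥0} (hv : v ≠ 0) (m : ℝ) {δ : ℝ} (hδ : 0 < δ) :
    ∫ w, deltaApprox δ (m + w) ∂gaussianReal 0 v ≤ (√(2 * Real.pi * v))⁻¹ := by
  rw [integral_deltaApprox_add_eq hv]
  calc _ ≤ ∫ y, (√(2 * Real.pi * v))⁻¹ * deltaApprox δ y := by
        refine integral_mono (integrable_gaussianPDFReal_mul_deltaApprox v m δ)
          ((integrable_deltaApprox δ).const_mul _) fun y => ?_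
        refine mul_le_mul_of_nonneg_right ?_ (deltaApprox_nonneg hδ y)
        rw [gaussianPDFReal]
        refine mul_le_of_le_one_right (by positivity) (Real.exp_le_one_iff.mpr ?_)
        rw [neg_div]
        exact neg_nonpos.mpr (by positivity)
    _ = _ := by rw [integral_const_mul, integral_deltaApprox hδ, mul_one]

theorem le_integral_deltaApprox_add {v : ℝ≥0} (hv : v ≠ 0) {m u δ : ℝ} (hδ : 0 < δ)
    (hu : |m| + δ ≤ u) :
    (√(2 * Real.pi * v))⁻¹ * Real.exp (-(u ^ 2 / (2 * v))) ≤
      ∫ w, deltaApprox δ (m + w) ∂gaussianReal 0 v := by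
  rw [integral_deltaApprox_add_eq hv]
  calc _ = ∫ y, (√(2 * Real.pi * v))⁻¹ * Real.exp (-(u ^ 2 / (2 * v))) * deltaApprox δ y := by
        rw [integral_const_mul, integral_deltaApprox hδ, mul_one]
    _ ≤ _ := by
        refine integral_mono ((integrable_deltaApprox δ).const_mul _)
          (integrable_gaussianPDFReal_mul_deltaApprox v m δ) fun y => ?_
        rcases le_or_gt δ |y| with hy | hy
        · simp only [deltaApprox_eq_zero hy, mul_zero, le_refl]
        refine mul_le_mul_of_nonneg_right ?_ (deltaApprox_nonneg hδ y)
        have hdist : |y - m| ≤ u := (abs_sub _ _).trans (by linarith)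
        have hsq : (y - m) ^ 2 ≤ u ^ 2 := sq_le_sq' (abs_le.mp hdist).1 (abs_le.mp hdist).2
        rw [gaussianPDFReal, sub_zero, neg_div]
        gcongr

/-- The density at the origin of a standard Gaussian vector with correlation `√(1 - v)`. -/
def originDensity (v : ℝ) : ℝ := (2 * Real.pi)⁻¹ * (1 / √v)

/-- A lower bound for the density of a standard Gaussian vector with correlation `√(1 - v)` at the
points `(x, y)` with `|x| + |y| ≤ u`. -/
def originDensityLower (v u : ℝ) : ℝ :=
  originDensity v * Real.exp (-(u ^ 2 / (2 * v) + u ^ 2 / 2))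

theorem inv_sqrt_mul_inv_sqrt (v : ℝ) :
    (√(2 * Real.pi * v))⁻¹ * (√(2 * Real.pi))⁻¹ = originDensity v := by
  have hpi : 0 ≤ 2 * Real.pi := by positivity
  rw [Real.sqrt_mul hpi, originDensity, mul_inv, mul_right_comm, ← mul_inv,
    Real.mul_self_sqrt hpi, one_div]

section GaussianPair

variable {Ω : Type*} [MeasurableSpace Ω] {P : Measure Ω} {A : Submodule ℝ (Lp ℝ 2 P)}
  {X Y : Lp ℝ 2 P} {v : ℝ≥0} {ε δ : ℝ}

namespace IsGaussianLinearSpace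

theorem indepFun_of_inner_eq_zero (hA : IsGaussianLinearSpace A) (hX : X ∈ A) (hY : Y ∈ A)
    (h : inner ℝ X Y = 0) : IndepFun X Y P := by
  have hind : iIndepFun (fun i => (![X, Y] i : Ω → ℝ)) P := by
    refine hA.iIndepFun_of_orthogonal (fun i => ?_) fun i j hij => ?_
    · fin_cases i
      exacts [hX, hY]
    · fin_cases i <;> fin_cases j
      exacts [absurd rfl hij, h, (real_inner_comm _ _).trans h, absurd rfl hij]
  exact hind.indepFun (i := 0) (j := 1) zero_ne_one

theorem hasLaw_prodMk_sub_inner_smul (hA : IsGaussianLinearSpace A) (hX : X ∈ A) (hY : Y ∈ A)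
    (hXnorm : ‖X‖ = 1) (hYnorm : ‖Y‖ = 1) (hv : (v : ℝ) = 1 - inner ℝ X Y ^ 2) :
    HasLaw (fun ω => (X ω, (Y - inner ℝ X Y • X) ω))
      ((gaussianReal 0 1).prod (gaussianReal 0 v)) P := by
  set W : Lp ℝ 2 P := Y - inner ℝ X Y • X with hW
  have hWmem : W ∈ A := Submodule.sub_mem _ hY (Submodule.smul_mem _ _ hX)
  have horth : inner ℝ X W = 0 := by
    rw [hW, inner_sub_right, real_inner_smul_right, real_inner_self_eq_norm_sq, hXnorm, one_pow,
      mul_one, sub_self]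
  have hWnorm : ‖W‖₊ ^ 2 = v := by
    refine NNReal.eq ?_
    rw [NNReal.coe_pow, coe_nnnorm, hv, hW, norm_sub_sq_real, norm_smul, hXnorm, hYnorm,
      real_inner_smul_right, real_inner_comm X Y, Real.norm_eq_abs, mul_one, sq_abs]
    ring
  have hWlaw : HasLaw W (gaussianReal 0 v) P := hWnorm ▸ hA W hWmem
  have := hWlaw.isProbabilityMeasure
  exact IndepFun.hasLaw_prod (hA.hasLaw hX hXnorm) hWlaw
    (hA.indepFun_of_inner_eq_zero hX hWmem horth)

end IsGaussianLinearSpace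

theorem integrable_deltaApprox_mul_deltaApprox_add (ε δ ρ : ℝ) (v : ℝ≥0) :
    Integrable (fun z : ℝ × ℝ => deltaApprox ε z.1 * deltaApprox δ (ρ * z.1 + z.2))
      ((gaussianReal 0 1).prod (gaussianReal 0 v)) := by
  refine (integrable_deltaApprox_comp ε (by fun_prop)).mul_bdd (c := |(2 * δ)⁻¹|) ?_
    (Eventually.of_forall fun _ => norm_deltaApprox_le _ _)
  exact Measurable.aestronglyMeasurable (by fun_prop)

theorem integrable_deltaApprox_mul_integral (ε δ ρ : ℝ) (v : ℝ≥0) :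
    Integrable (fun x => deltaApprox ε x * ∫ w, deltaApprox δ (ρ * x + w) ∂gaussianReal 0 v)
      (gaussianReal 0 1) := by
  simpa only [integral_const_mul] using
    (integrable_deltaApprox_mul_deltaApprox_add ε δ ρ v).integral_prod_left

namespace IsGaussianLinearSpace

theorem integral_deltaApprox_mul_deltaApprox (hA : IsGaussianLinearSpace A) (hX : X ∈ A)
    (hY : Y ∈ A) (hXnorm : ‖X‖ = 1) (hYnorm : ‖Y‖ = 1) (hv : (v : ℝ) = 1 - inner ℝ X Y ^ 2)
    (ε δ : ℝ) :
    ∫ ω, deltaApprox ε (X ω) * deltaApprox δ (Y ω) ∂P =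
      ∫ x, deltaApprox ε x * ∫ w, deltaApprox δ (inner ℝ X Y * x + w) ∂gaussianReal 0 v
        ∂gaussianReal 0 1 := by
  have h_int := integrable_deltaApprox_mul_deltaApprox_add ε δ (inner ℝ X Y) v
  have hlaw := hA.hasLaw_prodMk_sub_inner_smul hX hY hXnorm hYnorm hv
  simp only [← integral_const_mul]
  rw [← integral_prod _ h_int, ← hlaw.integral_comp h_int.aestronglyMeasurable]
  refine integral_congr_ae ?_
  filter_upwards [Lp.coeFn_sub Y (inner ℝ X Y • X), Lp.coeFn_smul (inner ℝ X Y) X]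
    with ω hsub hsmul
  rw [Function.comp_apply, hsub, Pi.sub_apply, hsmul, Pi.smul_apply, smul_eq_mul, add_sub_cancel]

theorem integral_deltaApprox_mul_deltaApprox_le (hA : IsGaussianLinearSpace A) (hX : X ∈ A)
    (hY : Y ∈ A) (hXnorm : ‖X‖ = 1) (hYnorm : ‖Y‖ = 1) (hXY : inner ℝ X Y ^ 2 < 1) (hε : 0 < ε)
    (hδ : 0 < δ) :
    ∫ ω, deltaApprox ε (X ω) * deltaApprox δ (Y ω) ∂P ≤ originDensity (1 - inner ℝ X Y ^ 2) := by
  lift 1 - inner ℝ X Y ^ 2 to ℝ≥0 using by linarith with v hv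
  have hv0 : v ≠ 0 := fun h => by rw [h, NNReal.coe_zero] at hv; linarith
  have hball := integral_deltaApprox_add_le one_ne_zero 0 hε
  simp only [zero_add, NNReal.coe_one, mul_one] at hball
  rw [hA.integral_deltaApprox_mul_deltaApprox hX hY hXnorm hYnorm hv ε δ,
    ← inv_sqrt_mul_inv_sqrt]
  calc _ ≤ ∫ x, (√(2 * Real.pi * v))⁻¹ * deltaApprox ε x ∂gaussianReal 0 1 := by
        refine integral_mono (integrable_deltaApprox_mul_integral ε δ _ v)
          ((integrable_deltaApprox_comp ε aemeasurable_id).const_mul _) fun x => ?_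
        rw [mul_comm (deltaApprox ε x)]
        exact mul_le_mul_of_nonneg_right (integral_deltaApprox_add_le hv0 _ hδ)
          (deltaApprox_nonneg hε x)
    _ ≤ _ := by
        rw [integral_const_mul]
        gcongr

theorem le_integral_deltaApprox_mul_deltaApprox (hA : IsGaussianLinearSpace A) (hX : X ∈ A)
    (hY : Y ∈ A) (hXnorm : ‖X‖ = 1) (hYnorm : ‖Y‖ = 1) (hXY : inner ℝ X Y ^ 2 < 1) (hε : 0 < ε)
    (hδ : 0 < δ) :
    originDensityLower (1 - inner ℝ X Y ^ 2) (ε + δ) ≤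
      ∫ ω, deltaApprox ε (X ω) * deltaApprox δ (Y ω) ∂P := by
  have hcorr : |inner ℝ X Y| ≤ 1 := (sq_le_one_iff_abs_le_one _).mp hXY.le
  lift 1 - inner ℝ X Y ^ 2 to ℝ≥0 using by linarith with v hv
  have hv0 : v ≠ 0 := fun h => by rw [h, NNReal.coe_zero] at hv; linarith
  have hball := le_integral_deltaApprox_add (m := 0) (u := ε + δ) one_ne_zero hε
    (by rw [abs_zero]; linarith)
  simp only [zero_add, NNReal.coe_one, mul_one] at hball
  rw [hA.integral_deltaApprox_mul_deltaApprox hX hY hXnorm hYnorm hv ε δ]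
  set c : ℝ := (√(2 * Real.pi * v))⁻¹ * Real.exp (-((ε + δ) ^ 2 / (2 * v)))
  calc _ = c * ((√(2 * Real.pi))⁻¹ * Real.exp (-((ε + δ) ^ 2 / 2))) := by
        rw [originDensityLower, neg_add, Real.exp_add, ← inv_sqrt_mul_inv_sqrt]
        ring
    _ ≤ c * ∫ x, deltaApprox ε x ∂gaussianReal 0 1 := by gcongr
    _ = ∫ x, c * deltaApprox ε x ∂gaussianReal 0 1 := (integral_const_mul _ _).symm
    _ ≤ _ := by
        refine integral_mono ((integrable_deltaApprox_comp ε aemeasurable_id).const_mul _)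
          (integrable_deltaApprox_mul_integral ε δ _ v) fun x => ?_
        rcases le_or_gt ε |x| with hx | hx
        · simp only [deltaApprox_eq_zero hx, mul_zero, zero_mul, le_refl]
        have hmean : |inner ℝ X Y * x| ≤ ε := by
          rw [abs_mul]
          exact (mul_le_of_le_one_left (abs_nonneg x) hcorr).trans hx.le
        rw [mul_comm c]
        exact mul_le_mul_of_nonneg_left (le_integral_deltaApprox_add hv0 hδ (by linarith))
          (deltaApprox_nonneg hε x)

end IsGaussianLinearSpace

end GaussianPair

/-! ### The second moment of the approximations of the Leray measure -/

/-- The second moment of the Leray measure: the integral of the density at the origin of the pair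
`(T_n(x), T_n(0))`. -/
def lerayMoment (n : ℕ) : ℝ := ∫ x : Torus, originDensity (1 - waveCov n x ^ 2)

/-- A lower bound for the mixed moments of the approximations of the Leray measure at scales that
add up to `u`. -/
def lerayMomentLower (n : ℕ) (u : ℝ) : ℝ :=
  ∫ x : Torus, originDensityLower (1 - waveCov n x ^ 2) u

theorem originDensity_nonneg (v : ℝ) : 0 ≤ originDensity v := by
  unfold originDensity
  positivity

theorem norm_originDensityLower_le {v : ℝ} (hv : 0 ≤ v) (u : ℝ) :
    ‖originDensityLower v u‖ ≤ originDensity v := by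
  rw [originDensityLower, norm_mul, Real.norm_of_nonneg (originDensity_nonneg v), Real.norm_eq_abs,
    Real.abs_exp]
  exact mul_le_of_le_one_right (originDensity_nonneg v)
    (Real.exp_le_one_iff.mpr (neg_nonpos.mpr (by positivity)))

section Moment

variable {n : ℕ}

theorem integrable_originDensity_waveCov (hn : 0 < n) :
    Integrable fun x : Torus => originDensity (1 - waveCov n x ^ 2) :=
  (integrable_inv_sqrt hn).const_mul _

theorem norm_originDensityLower_waveCov_le (n : ℕ) (u : ℝ) (x : Torus) :
    ‖originDensityLower (1 - waveCov n x ^ 2) u‖ ≤ originDensity (1 - waveCov n x ^ 2) :=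
  norm_originDensityLower_le (sub_nonneg.mpr (waveCov_sq_le_one n x)) u

theorem measurable_originDensityLower_waveCov (n : ℕ) (u : ℝ) :
    Measurable fun x : Torus => originDensityLower (1 - waveCov n x ^ 2) u := by
  have hcov : Measurable (waveCov n) := (continuous_waveCov n).measurable
  unfold originDensityLower originDensity
  fun_prop

theorem integrable_originDensityLower_waveCov (hn : 0 < n) (u : ℝ) :
    Integrable fun x : Torus => originDensityLower (1 - waveCov n x ^ 2) u :=
  (integrable_originDensity_waveCov hn).mono'
    (measurable_originDensityLower_waveCov n u).aestronglyMeasurable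
    (Eventually.of_forall (norm_originDensityLower_waveCov_le n u))

theorem tendsto_lerayMomentLower (hn : 0 < n) :
    Tendsto (lerayMomentLower n) (𝓝 0) (𝓝 (lerayMoment n)) := by
  refine tendsto_integral_filter_of_dominated_convergence
    (fun x => originDensity (1 - waveCov n x ^ 2))
    (Eventually.of_forall fun u => (measurable_originDensityLower_waveCov n u).aestronglyMeasurable)
    (Eventually.of_forall fun u => Eventually.of_forall (norm_originDensityLower_waveCov_le n u))
    (integrable_originDensity_waveCov hn) (Eventually.of_forall fun x => ?_)
  have hcont : Continuous (originDensityLower (1 - waveCov n x ^ 2)) := by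
    unfold originDensityLower
    fun_prop
  have h := hcont.tendsto 0
  have hzero : originDensityLower (1 - waveCov n x ^ 2) 0 =
      originDensity (1 - waveCov n x ^ 2) := by
    simp [originDensityLower]
  rwa [hzero] at h

theorem hasSum_lerayMoment (hn : 0 < n) :
    HasSum (fun q => (2 * Real.pi)⁻¹ * (centralCoeff q * ∫ x, waveCov n x ^ (2 * q)))
      (lerayMoment n) := by
  unfold lerayMoment originDensity
  rw [integral_const_mul]
  exact (hasSum_integral_inv_sqrt hn).mul_left _

theorem lerayMoment_eq_integral_sub (n : ℕ) (x : Torus) :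
    lerayMoment n = ∫ y : Torus, originDensity (1 - waveCov n (y - x) ^ 2) :=
  (integral_sub_right_eq_self (fun y : Torus => originDensity (1 - waveCov n y ^ 2)) x).symm

theorem lerayMomentLower_eq_integral_sub (n : ℕ) (u : ℝ) (x : Torus) :
    lerayMomentLower n u = ∫ y : Torus, originDensityLower (1 - waveCov n (y - x) ^ 2) u :=
  (integral_sub_right_eq_self (fun y : Torus => originDensityLower (1 - waveCov n y ^ 2) u)
    x).symm

theorem ae_waveCov_sub_sq_lt_one (hn : 0 < n) (x : Torus) :
    ∀ᵐ y : Torus, waveCov n (y - x) ^ 2 < 1 :=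
  (measurePreserving_sub_right volume x).quasiMeasurePreserving.ae (ae_waveCov_sq_lt_one hn)

end Moment

section Leray

theorem lerayApprox_eq_integral {Ω : Type*} (a : (Fin 2 → ℤ) → Ω → ℂ) (n : ℕ) (ε : ℝ) (ω : Ω)
    (h : Measurable fun x => wave a n x ω) :
    lerayApprox a n ε ω = ∫ x, deltaApprox ε (wave a n x ω) := by
  have hset : MeasurableSet {x | |wave a n x ω| < ε} := measurableSet_lt h.abs measurable_const
  have hind : (fun x => deltaApprox ε (wave a n x ω)) =
      {x | |wave a n x ω| < ε}.indicator fun _ => (2 * ε)⁻¹ := by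
    funext x
    simp only [deltaApprox, Set.indicator_apply, Set.mem_Ioo, Set.mem_ofPred_eq, abs_lt]
  rw [hind, integral_indicator hset, setIntegral_const, smul_eq_mul, mul_comm, lerayApprox]

variable {Ω : Type*} [MeasurableSpace Ω] {a : (Fin 2 → ℤ) → Ω → ℂ} {P : Measure Ω} {n : ℕ}

theorem measurable_uncurry_deltaApprox_wave (ha : IsGaussianCoefficients a P) (hn : 0 < n)
    (ε : ℝ) : Measurable fun z : Ω × Torus => deltaApprox ε (wave a n z.2 z.1) := by
  have hswap : Measurable fun z : Ω × Torus => (z.2, z.1) := measurable_swap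
  have hwave := (measurable_uncurry_wave ha hn).comp hswap
  exact (measurable_deltaApprox ε).comp hwave

theorem lerayApprox_eq (ha : IsGaussianCoefficients a P) (hn : 0 < n) (ε : ℝ) :
    lerayApprox a n ε = fun ω => ∫ x, deltaApprox ε (wave a n x ω) := by
  funext ω
  have hmk : Measurable fun x : Torus => (x, ω) := measurable_prodMk_right
  have hwave := (measurable_uncurry_wave ha hn).comp hmk
  exact lerayApprox_eq_integral a n ε ω hwave

theorem measurable_lerayApprox (ha : IsGaussianCoefficients a P) (hn : 0 < n) (ε : ℝ) :
    Measurable (lerayApprox a n ε) := by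
  rw [lerayApprox_eq ha hn]
  exact (measurable_uncurry_deltaApprox_wave ha hn
    ε).stronglyMeasurable.integral_prod_right'.measurable

variable [IsProbabilityMeasure P]

theorem memLp_lerayApprox (ha : IsGaussianCoefficients a P) (hn : 0 < n) (ε : ℝ) :
    MemLp (lerayApprox a n ε) 2 P := by
  refine MemLp.of_bound (measurable_lerayApprox ha hn ε).aestronglyMeasurable |(2 * ε)⁻¹|
    (Eventually.of_forall fun ω => ?_)
  rw [lerayApprox, norm_mul, Real.norm_of_nonneg measureReal_nonneg]
  exact mul_le_of_le_one_right (norm_nonneg _) measureReal_le_one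

theorem memLp_deltaApprox_waveLp (ha : IsGaussianCoefficients a P) (hn : 0 < n) (ε : ℝ)
    (x : Torus) : MemLp (fun ω => deltaApprox ε (waveLp ha hn x ω)) 2 P :=
  MemLp.of_bound
    ((measurable_deltaApprox ε).comp_aemeasurable (aemeasurable_Lp _)).aestronglyMeasurable
    |(2 * ε)⁻¹| (Eventually.of_forall fun _ => norm_deltaApprox_le _ _)

/-- The approximation of the Leray measure, as an element of `L²(P)`. -/
def lerayLp (ha : IsGaussianCoefficients a P) (hn : 0 < n) (ε : ℝ) : Lp ℝ 2 P :=
  (memLp_lerayApprox ha hn ε).toLp _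

/-- The integrand of the approximation of the Leray measure, as an element of `L²(P)`. -/
def deltaLp (ha : IsGaussianCoefficients a P) (hn : 0 < n) (ε : ℝ) (x : Torus) : Lp ℝ 2 P :=
  (memLp_deltaApprox_waveLp ha hn ε x).toLp _

theorem coeFn_deltaLp (ha : IsGaussianCoefficients a P) (hn : 0 < n) (ε : ℝ) (x : Torus) :
    deltaLp ha hn ε x =ᵐ[P] fun ω => deltaApprox ε (waveLp ha hn x ω) :=
  MemLp.coeFn_toLp _

theorem inner_deltaLp (ha : IsGaussianCoefficients a P) (hn : 0 < n) (ε : ℝ) (x : Torus)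
    (G : Lp ℝ 2 P) :
    inner ℝ (deltaLp ha hn ε x) G = ∫ ω, deltaApprox ε (waveLp ha hn x ω) * G ω ∂P := by
  rw [inner_eq_integral_mul]
  refine integral_congr_ae ?_
  filter_upwards [coeFn_deltaLp ha hn ε x] with ω hω
  rw [hω]

theorem inner_deltaLp_eq_integral_wave (ha : IsGaussianCoefficients a P) (hn : 0 < n) (ε : ℝ)
    (x : Torus) (G : Lp ℝ 2 P) :
    inner ℝ (deltaLp ha hn ε x) G = ∫ ω, deltaApprox ε (wave a n x ω) * G ω ∂P := by
  rw [inner_deltaLp]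
  refine integral_congr_ae ?_
  filter_upwards [coeFn_waveLp ha hn x] with ω hω
  rw [hω]

theorem integrable_deltaApprox_wave_mul (ha : IsGaussianCoefficients a P) (hn : 0 < n) (ε : ℝ)
    (G : Lp ℝ 2 P) :
    Integrable (fun z : Ω × Torus => deltaApprox ε (wave a n z.2 z.1) * G z.1)
      (P.prod volume) :=
  (((Lp.memLp G).integrable one_le_two).comp_fst volume).bdd_mul (c := |(2 * ε)⁻¹|)
    (measurable_uncurry_deltaApprox_wave ha hn ε).aestronglyMeasurable
    (Eventually.of_forall fun _ => norm_deltaApprox_le _ _)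

theorem integrable_inner_deltaLp (ha : IsGaussianCoefficients a P) (hn : 0 < n) (ε : ℝ)
    (G : Lp ℝ 2 P) : Integrable fun x => inner ℝ (deltaLp ha hn ε x) G := by
  simp only [inner_deltaLp_eq_integral_wave]
  exact (integrable_deltaApprox_wave_mul ha hn ε G).integral_prod_right

theorem inner_lerayLp (ha : IsGaussianCoefficients a P) (hn : 0 < n) (ε : ℝ) (G : Lp ℝ 2 P) :
    inner ℝ (lerayLp ha hn ε) G = ∫ x, inner ℝ (deltaLp ha hn ε x) G := by
  simp only [inner_deltaLp_eq_integral_wave]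
  rw [← integral_integral_swap (integrable_deltaApprox_wave_mul ha hn ε G), inner_eq_integral_mul]
  refine integral_congr_ae ?_
  filter_upwards [(memLp_lerayApprox ha hn ε).coeFn_toLp] with ω hω
  rw [lerayLp, hω, lerayApprox_eq ha hn, integral_mul_const]

theorem inner_deltaLp_deltaLp (ha : IsGaussianCoefficients a P) (hn : 0 < n) (ε δ : ℝ)
    (x y : Torus) : inner ℝ (deltaLp ha hn ε x) (deltaLp ha hn δ y) =
      ∫ ω, deltaApprox ε (waveLp ha hn x ω) * deltaApprox δ (waveLp ha hn y ω) ∂P := by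
  rw [inner_deltaLp]
  refine integral_congr_ae ?_
  filter_upwards [coeFn_deltaLp ha hn δ y] with ω hω
  rw [hω]

section Bounds

variable {ε δ : ℝ}

theorem inner_deltaLp_deltaLp_le (ha : IsGaussianCoefficients a P) (hn : 0 < n)
    (hS : n ∈ sumsOfTwoSquares) (hε : 0 < ε) (hδ : 0 < δ) {x y : Torus}
    (hxy : waveCov n (x - y) ^ 2 < 1) :
    inner ℝ (deltaLp ha hn ε x) (deltaLp ha hn δ y) ≤
      originDensity (1 - waveCov n (x - y) ^ 2) := by
  rw [← inner_waveLp ha hn x y] at hxy ⊢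
  rw [inner_deltaLp_deltaLp]
  exact (isGaussianLinearSpace_gaussianSpace ha).integral_deltaApprox_mul_deltaApprox_le
    (waveLp_mem_gaussianSpace ha hn x) (waveLp_mem_gaussianSpace ha hn y) (norm_waveLp ha hn hS x)
    (norm_waveLp ha hn hS y) hxy hε hδ

theorem le_inner_deltaLp_deltaLp (ha : IsGaussianCoefficients a P) (hn : 0 < n)
    (hS : n ∈ sumsOfTwoSquares) (hε : 0 < ε) (hδ : 0 < δ) {x y : Torus}
    (hxy : waveCov n (x - y) ^ 2 < 1) :
    originDensityLower (1 - waveCov n (x - y) ^ 2) (ε + δ) ≤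
      inner ℝ (deltaLp ha hn ε x) (deltaLp ha hn δ y) := by
  rw [← inner_waveLp ha hn x y] at hxy ⊢
  rw [inner_deltaLp_deltaLp]
  exact (isGaussianLinearSpace_gaussianSpace ha).le_integral_deltaApprox_mul_deltaApprox
    (waveLp_mem_gaussianSpace ha hn x) (waveLp_mem_gaussianSpace ha hn y) (norm_waveLp ha hn hS x)
    (norm_waveLp ha hn hS y) hxy hε hδ

theorem inner_deltaLp_lerayLp_le (ha : IsGaussianCoefficients a P) (hn : 0 < n)
    (hS : n ∈ sumsOfTwoSquares) (hε : 0 < ε) (hδ : 0 < δ) (x : Torus) :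
    inner ℝ (deltaLp ha hn ε x) (lerayLp ha hn δ) ≤ lerayMoment n := by
  rw [real_inner_comm, inner_lerayLp, lerayMoment_eq_integral_sub n x]
  refine integral_mono_ae (integrable_inner_deltaLp ha hn δ _)
    ((integrable_originDensity_waveCov hn).comp_sub_right x) ?_
  filter_upwards [ae_waveCov_sub_sq_lt_one hn x] with y hxy
  exact inner_deltaLp_deltaLp_le ha hn hS hδ hε hxy

theorem le_inner_deltaLp_lerayLp (ha : IsGaussianCoefficients a P) (hn : 0 < n)
    (hS : n ∈ sumsOfTwoSquares) (hε : 0 < ε) (hδ : 0 < δ) (x : Torus) :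
    lerayMomentLower n (ε + δ) ≤ inner ℝ (deltaLp ha hn ε x) (lerayLp ha hn δ) := by
  rw [add_comm, real_inner_comm, inner_lerayLp, lerayMomentLower_eq_integral_sub n _ x]
  refine integral_mono_ae ((integrable_originDensityLower_waveCov hn (δ + ε)).comp_sub_right x)
    (integrable_inner_deltaLp ha hn δ _) ?_
  filter_upwards [ae_waveCov_sub_sq_lt_one hn x] with y hxy
  exact le_inner_deltaLp_deltaLp ha hn hS hδ hε hxy

theorem inner_lerayLp_lerayLp_le (ha : IsGaussianCoefficients a P) (hn : 0 < n)
    (hS : n ∈ sumsOfTwoSquares) (hε : 0 < ε) (hδ : 0 < δ) :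
    inner ℝ (lerayLp ha hn ε) (lerayLp ha hn δ) ≤ lerayMoment n := by
  rw [inner_lerayLp]
  exact (integral_mono (integrable_inner_deltaLp ha hn ε _) (integrable_const _)
    (inner_deltaLp_lerayLp_le ha hn hS hε hδ)).trans_eq (integral_const _ |>.trans (by simp))

theorem le_inner_lerayLp_lerayLp (ha : IsGaussianCoefficients a P) (hn : 0 < n)
    (hS : n ∈ sumsOfTwoSquares) (hε : 0 < ε) (hδ : 0 < δ) :
    lerayMomentLower n (ε + δ) ≤ inner ℝ (lerayLp ha hn ε) (lerayLp ha hn δ) := by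
  rw [inner_lerayLp]
  exact Eq.trans_le (by simp) (integral_mono (integrable_const _)
    (integrable_inner_deltaLp ha hn ε _) (le_inner_deltaLp_lerayLp ha hn hS hε hδ))

theorem norm_lerayLp_sub_sq_le (ha : IsGaussianCoefficients a P) (hn : 0 < n)
    (hS : n ∈ sumsOfTwoSquares) (hε : 0 < ε) (hδ : 0 < δ) :
    ‖lerayLp ha hn ε - lerayLp ha hn δ‖ ^ 2 ≤
      2 * (lerayMoment n - lerayMomentLower n (ε + δ)) := by
  rw [norm_sub_sq_real, ← real_inner_self_eq_norm_sq, ← real_inner_self_eq_norm_sq]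
  linarith [inner_lerayLp_lerayLp_le ha hn hS hε hε, inner_lerayLp_lerayLp_le ha hn hS hδ hδ,
    le_inner_lerayLp_lerayLp ha hn hS hε hδ]

end Bounds

theorem exists_tendsto_lerayLp (ha : IsGaussianCoefficients a P) (hn : 0 < n)
    (hS : n ∈ sumsOfTwoSquares) : ∃ Z : Lp ℝ 2 P, Tendsto (lerayLp ha hn) (𝓝[>] 0) (𝓝 Z) := by
  rw [← cauchy_map_iff_exists_tendsto, cauchy_map_iff', Metric.uniformity_eq_comap_nhds_zero,
    tendsto_comap_iff]
  have hadd : Tendsto (fun z : ℝ × ℝ => z.1 + z.2) (𝓝[>] 0 ×ˢ 𝓝[>] 0) (𝓝 0) := by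
    have h : Tendsto (fun z : ℝ × ℝ => z.1 + z.2) (𝓝 ((0 : ℝ), (0 : ℝ))) (𝓝 (0 + 0)) :=
      (continuous_fst.add continuous_snd).tendsto (0, 0)
    rw [add_zero, nhds_prod_eq] at h
    exact h.mono_left (Filter.prod_mono nhdsWithin_le_nhds nhdsWithin_le_nhds)
  have hsqrt :=
    ((((tendsto_lerayMomentLower hn).comp hadd).const_sub (lerayMoment n)).const_mul 2).sqrt
  rw [sub_self, mul_zero, Real.sqrt_zero] at hsqrt
  refine squeeze_zero' (Eventually.of_forall fun _ => dist_nonneg) ?_ hsqrt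
  have hpos : ∀ᶠ z : ℝ × ℝ in 𝓝[>] 0 ×ˢ 𝓝[>] 0, 0 < z.1 ∧ 0 < z.2 :=
    (eventually_mem_nhdsWithin.prod_inl _).and (eventually_mem_nhdsWithin.prod_inr _)
  filter_upwards [hpos] with z hz
  rw [Function.comp, dist_eq_norm]
  exact Real.le_sqrt_of_sq_le (norm_lerayLp_sub_sq_le ha hn hS hz.1 hz.2)

theorem isLerayMeasure_of_tendsto (ha : IsGaussianCoefficients a P) (hn : 0 < n) {Z : Lp ℝ 2 P}
    (hZ : Tendsto (lerayLp ha hn) (𝓝[>] 0) (𝓝 Z)) : IsLerayMeasure a P n Z :=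
  (tendstoInMeasure_of_tendsto_Lp hZ).congr (fun ε => (memLp_lerayApprox ha hn ε).coeFn_toLp)
    EventuallyEq.rfl

theorem norm_sq_of_tendsto_lerayLp (ha : IsGaussianCoefficients a P) (hn : 0 < n)
    (hS : n ∈ sumsOfTwoSquares) {Z : Lp ℝ 2 P} (hZ : Tendsto (lerayLp ha hn) (𝓝[>] 0) (𝓝 Z)) :
    ‖Z‖ ^ 2 = lerayMoment n := by
  refine tendsto_nhds_unique (hZ.norm.pow 2) ?_
  have hadd : Tendsto (fun ε : ℝ => ε + ε) (𝓝[>] 0) (𝓝 0) := by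
    have h : Tendsto (fun ε : ℝ => ε + ε) (𝓝 0) (𝓝 (0 + 0)) :=
      (continuous_id.add continuous_id).tendsto 0
    rw [add_zero] at h
    exact h.mono_left nhdsWithin_le_nhds
  refine tendsto_of_tendsto_of_tendsto_of_le_of_le' ((tendsto_lerayMomentLower hn).comp hadd)
    tendsto_const_nhds ?_ ?_ <;>
    filter_upwards [self_mem_nhdsWithin] with ε hε <;>
    rw [← real_inner_self_eq_norm_sq]
  exacts [le_inner_lerayLp_lerayLp ha hn hS hε hε, inner_lerayLp_lerayLp_le ha hn hS hε hε]

theorem inner_const_one (F : Lp ℝ 2 P) : inner ℝ F (Lp.const 2 P (1 : ℝ)) = ∫ ω, F ω ∂P := by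
  rw [inner_eq_integral_mul]
  refine integral_congr_ae ?_
  filter_upwards [Lp.coeFn_const (p := 2) (μ := P) (1 : ℝ)] with ω hω
  rw [hω, Function.const_apply, mul_one]

theorem integral_deltaLp (ha : IsGaussianCoefficients a P) (hn : 0 < n)
    (hS : n ∈ sumsOfTwoSquares) (ε : ℝ) (x : Torus) :
    ∫ ω, deltaLp ha hn ε x ω ∂P = ∫ y, deltaApprox ε y ∂gaussianReal 0 1 := by
  rw [integral_congr_ae (coeFn_deltaLp ha hn ε x)]
  exact (hasLaw_waveLp ha hn hS x).integral_comp (measurable_deltaApprox ε).aestronglyMeasurable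

theorem integral_of_tendsto_lerayLp (ha : IsGaussianCoefficients a P) (hn : 0 < n)
    (hS : n ∈ sumsOfTwoSquares) {Z : Lp ℝ 2 P} (hZ : Tendsto (lerayLp ha hn) (𝓝[>] 0) (𝓝 Z)) :
    ∫ ω, Z ω ∂P = (√(2 * Real.pi))⁻¹ := by
  rw [← inner_const_one]
  refine tendsto_nhds_unique (hZ.inner tendsto_const_nhds) ?_
  have h := tendsto_integral_deltaApprox_mul_hermiteFun 0
  simp only [hermiteFun_zero, mul_one] at h
  refine h.congr fun ε => ?_
  rw [inner_lerayLp]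
  simp [inner_const_one, integral_deltaLp ha hn hS]

theorem variance_eq_norm_sq_sub (F : Lp ℝ 2 P) :
    variance F P = ‖F‖ ^ 2 - (∫ ω, F ω ∂P) ^ 2 := by
  rw [variance_eq_sub (Lp.memLp F), norm_sq_eq_integral_sq]
  rfl

end Leray

/-! ### The chaotic components of the Leray measure -/

section Chaos

variable {Ω : Type*} [MeasurableSpace Ω] {a : (Fin 2 → ℤ) → Ω → ℂ} {P : Measure Ω}
  [IsProbabilityMeasure P] {n : ℕ}

theorem memLp_hermiteFun_waveLp (ha : IsGaussianCoefficients a P) (hn : 0 < n)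
    (hS : n ∈ sumsOfTwoSquares) (q : ℕ) (x : Torus) :
    MemLp (fun ω => hermiteFun q (waveLp ha hn x ω)) 2 P := by
  have h := memLp_hermiteFun q
  rw [← (hasLaw_waveLp ha hn hS x).map_eq] at h
  exact h.comp_of_map (aemeasurable_Lp _)

/-- The Hermite polynomial of the value of the wave at a point, as an element of `L²(P)`. -/
def hermiteLp (ha : IsGaussianCoefficients a P) (hn : 0 < n) (hS : n ∈ sumsOfTwoSquares) (q : ℕ)
    (x : Torus) : Lp ℝ 2 P :=
  (memLp_hermiteFun_waveLp ha hn hS q x).toLp _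

theorem coeFn_hermiteLp (ha : IsGaussianCoefficients a P) (hn : 0 < n)
    (hS : n ∈ sumsOfTwoSquares) (q : ℕ) (x : Torus) :
    hermiteLp ha hn hS q x =ᵐ[P] fun ω => hermiteFun q (waveLp ha hn x ω) :=
  MemLp.coeFn_toLp _

theorem hermiteLp_mem_wienerChaos (ha : IsGaussianCoefficients a P) (hn : 0 < n)
    (hS : n ∈ sumsOfTwoSquares) (q : ℕ) (x : Torus) :
    hermiteLp ha hn hS q x ∈ wienerChaos a P q := by
  refine Submodule.le_topologicalClosure _ (Submodule.subset_span
    ⟨1, fun _ => q, fun _ => waveLp ha hn x, le_rfl, by simp,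
      fun _ => waveLp_mem_gaussianSpace ha hn x, fun _ => hasLaw_waveLp ha hn hS x,
      iIndepFun.of_subsingleton, ?_⟩)
  filter_upwards [coeFn_hermiteLp ha hn hS q x] with ω hω
  simpa [hermiteFun] using hω

section HermiteProducts

variable {ι : Type*} [Fintype ι] (p : ι → ℕ) {ξ : ι → Lp ℝ 2 P} {F : Lp ℝ 2 P}

theorem inner_hermiteLp_of_prod (ha : IsGaussianCoefficients a P) (hn : 0 < n)
    (hS : n ∈ sumsOfTwoSquares) (hξ : ∀ i, ξ i ∈ gaussianSpace a P) (hon : Orthonormal ℝ ξ)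
    (hF : ∀ᵐ ω ∂P, F ω = ∏ i, hermiteFun (p i) (ξ i ω)) (x : Torus) :
    inner ℝ (hermiteLp ha hn hS (∑ i, p i) x) F =
      (∏ i, inner ℝ (ξ i) (waveLp ha hn x) ^ p i) * (∑ i, p i).factorial := by
  rw [inner_eq_integral_mul, ← integral_hermiteFun_sq,
    ← (isGaussianLinearSpace_gaussianSpace ha).integral_comp_mul_prod_hermiteFun
      (waveLp_mem_gaussianSpace ha hn x) (norm_waveLp ha hn hS x) p hξ hon
      ((Lp.memLp F).integrable one_le_two) hF (continuous_hermiteFun _).measurable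
      ((memLp_hermiteFun_waveLp ha hn hS _ x).integrable_mul (Lp.memLp F))
      (integrable_hermiteFun_mul _ _)]
  refine integral_congr_ae ?_
  filter_upwards [coeFn_hermiteLp ha hn hS (∑ i, p i) x] with ω hω
  rw [hω]

theorem inner_deltaLp_of_prod (ha : IsGaussianCoefficients a P) (hn : 0 < n)
    (hS : n ∈ sumsOfTwoSquares) (hξ : ∀ i, ξ i ∈ gaussianSpace a P) (hon : Orthonormal ℝ ξ)
    (hF : ∀ᵐ ω ∂P, F ω = ∏ i, hermiteFun (p i) (ξ i ω)) (ε : ℝ) (x : Torus) :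
    inner ℝ (deltaLp ha hn ε x) F = (∏ i, inner ℝ (ξ i) (waveLp ha hn x) ^ p i) *
      ∫ y, deltaApprox ε y * hermiteFun (∑ i, p i) y ∂gaussianReal 0 1 := by
  rw [inner_deltaLp]
  exact (isGaussianLinearSpace_gaussianSpace ha).integral_comp_mul_prod_hermiteFun
    (waveLp_mem_gaussianSpace ha hn x) (norm_waveLp ha hn hS x) p hξ hon
    ((Lp.memLp F).integrable one_le_two) hF (measurable_deltaApprox ε)
    ((memLp_deltaApprox_waveLp ha hn ε x).integrable_mul (Lp.memLp F))
    (((memLp_hermiteFun _).integrable one_le_two).bdd_mul (c := |(2 * ε)⁻¹|)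
      (measurable_deltaApprox ε).aestronglyMeasurable
      (Eventually.of_forall fun _ => norm_deltaApprox_le _ _))

end HermiteProducts

theorem inner_hermiteLp (ha : IsGaussianCoefficients a P) (hn : 0 < n)
    (hS : n ∈ sumsOfTwoSquares) (q : ℕ) (x y : Torus) :
    inner ℝ (hermiteLp ha hn hS q x) (hermiteLp ha hn hS q y) =
      q.factorial * waveCov n (x - y) ^ q := by
  have hon : Orthonormal ℝ fun _ : Fin 1 => waveLp ha hn y :=
    orthonormal_of_iIndepFun (fun _ => hasLaw_waveLp ha hn hS y) iIndepFun.of_subsingleton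
  have hprod : ∀ᵐ ω ∂P,
      hermiteLp ha hn hS q y ω = ∏ _ : Fin 1, hermiteFun q (waveLp ha hn y ω) := by
    filter_upwards [coeFn_hermiteLp ha hn hS q y] with ω hω
    simpa using hω
  have h := inner_hermiteLp_of_prod (fun _ : Fin 1 => q) ha hn hS
    (fun _ => waveLp_mem_gaussianSpace ha hn y) hon hprod x
  simpa [real_inner_comm, inner_waveLp, mul_comm] using h

theorem norm_hermiteLp_sub (ha : IsGaussianCoefficients a P) (hn : 0 < n)
    (hS : n ∈ sumsOfTwoSquares) (q : ℕ) (x y : Torus) :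
    ‖hermiteLp ha hn hS q x - hermiteLp ha hn hS q y‖ =
      √(2 * q.factorial * (1 - waveCov n (x - y) ^ q)) := by
  rw [← Real.sqrt_sq (norm_nonneg (_ - _)), norm_sub_sq_real, ← real_inner_self_eq_norm_sq,
    ← real_inner_self_eq_norm_sq, inner_hermiteLp, inner_hermiteLp, inner_hermiteLp, sub_self,
    sub_self, waveCov_zero hS, one_pow]
  congr 1
  ring

theorem continuous_hermiteLp (ha : IsGaussianCoefficients a P) (hn : 0 < n)
    (hS : n ∈ sumsOfTwoSquares) (q : ℕ) : Continuous (hermiteLp ha hn hS q) := by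
  refine continuous_iff_continuousAt.mpr fun y => tendsto_iff_norm_sub_tendsto_zero.mpr ?_
  simp only [norm_hermiteLp_sub]
  have hcont : Continuous fun x : Torus => √(2 * q.factorial * (1 - waveCov n (x - y) ^ q)) := by
    have := continuous_waveCov n
    fun_prop
  have h := hcont.tendsto y
  simpa [waveCov_zero hS] using h

theorem integrable_hermiteLp (ha : IsGaussianCoefficients a P) (hn : 0 < n)
    (hS : n ∈ sumsOfTwoSquares) (q : ℕ) : Integrable (hermiteLp ha hn hS q) :=
  integrable_of_continuous (continuous_hermiteLp ha hn hS q)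

theorem integral_hermiteLp_mem_wienerChaos (ha : IsGaussianCoefficients a P) (hn : 0 < n)
    (hS : n ∈ sumsOfTwoSquares) (q : ℕ) : ∫ x, hermiteLp ha hn hS q x ∈ wienerChaos a P q :=
  (wienerChaos a P q).convex.integral_mem (Submodule.isClosed_topologicalClosure _)
    (Eventually.of_forall fun x => hermiteLp_mem_wienerChaos ha hn hS q x)
    (integrable_hermiteLp ha hn hS q)

theorem inner_integral_hermiteLp (ha : IsGaussianCoefficients a P) (hn : 0 < n)
    (hS : n ∈ sumsOfTwoSquares) (q : ℕ) (F : Lp ℝ 2 P) :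
    inner ℝ (∫ x, hermiteLp ha hn hS q x) F = ∫ x, inner ℝ (hermiteLp ha hn hS q x) F := by
  rw [real_inner_comm, ← integral_inner (integrable_hermiteLp ha hn hS q)]
  simp only [real_inner_comm]

theorem norm_sq_integral_hermiteLp (ha : IsGaussianCoefficients a P) (hn : 0 < n)
    (hS : n ∈ sumsOfTwoSquares) (q : ℕ) :
    ‖∫ x, hermiteLp ha hn hS q x‖ ^ 2 = q.factorial * ∫ x, waveCov n x ^ q := by
  have hinner (x : Torus) : inner ℝ (hermiteLp ha hn hS q x) (∫ y, hermiteLp ha hn hS q y) =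
      q.factorial * ∫ x, waveCov n x ^ q := by
    rw [real_inner_comm, inner_integral_hermiteLp]
    simp only [inner_hermiteLp, integral_const_mul]
    rw [integral_sub_right_eq_self (fun y => waveCov n y ^ q) x]
  rw [← real_inner_self_eq_norm_sq, inner_integral_hermiteLp]
  simp [hinner]

theorem integral_coeFn_hermiteLp_succ (ha : IsGaussianCoefficients a P) (hn : 0 < n)
    (hS : n ∈ sumsOfTwoSquares) (q : ℕ) (x : Torus) :
    ∫ ω, hermiteLp ha hn hS (q + 1) x ω ∂P = 0 := by
  rw [integral_congr_ae (coeFn_hermiteLp ha hn hS _ x), ← integral_hermiteFun_succ q]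
  exact (hasLaw_waveLp ha hn hS x).integral_comp (continuous_hermiteFun _).aestronglyMeasurable

/-- The `q`-th chaotic component of the Leray measure: the `q`-th term of the expansion of the
Dirac mass at `0` in Hermite polynomials, integrated along the wave. -/
def lerayComponent (ha : IsGaussianCoefficients a P) (hn : 0 < n) (hS : n ∈ sumsOfTwoSquares)
    (q : ℕ) : Lp ℝ 2 P :=
  ((√(2 * Real.pi))⁻¹ * hermiteFun q 0 / q.factorial) • ∫ x, hermiteLp ha hn hS q x

theorem inner_lerayComponent_of_prod (ha : IsGaussianCoefficients a P) (hn : 0 < n)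
    (hS : n ∈ sumsOfTwoSquares) {ι : Type*} [Fintype ι] (p : ι → ℕ) {ξ : ι → Lp ℝ 2 P}
    {F : Lp ℝ 2 P} (hξ : ∀ i, ξ i ∈ gaussianSpace a P) (hon : Orthonormal ℝ ξ)
    (hF : ∀ᵐ ω ∂P, F ω = ∏ i, hermiteFun (p i) (ξ i ω)) :
    inner ℝ (lerayComponent ha hn hS (∑ i, p i)) F =
      (∫ x, ∏ i, inner ℝ (ξ i) (waveLp ha hn x) ^ p i) *
        ((√(2 * Real.pi))⁻¹ * hermiteFun (∑ i, p i) 0) := by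
  have hfact : ((∑ i, p i).factorial : ℝ) ≠ 0 := by exact_mod_cast Nat.factorial_ne_zero _
  rw [lerayComponent, real_inner_smul_left, inner_integral_hermiteLp]
  simp only [inner_hermiteLp_of_prod p ha hn hS hξ hon hF, integral_mul_const]
  field_simp

section Limit

variable {Z : Lp ℝ 2 P}

theorem inner_eq_inner_lerayComponent_of_prod (ha : IsGaussianCoefficients a P) (hn : 0 < n)
    (hS : n ∈ sumsOfTwoSquares) (hZ : Tendsto (lerayLp ha hn) (𝓝[>] 0) (𝓝 Z)) {ι : Type*}
    [Fintype ι] (p : ι → ℕ) {ξ : ι → Lp ℝ 2 P} {F : Lp ℝ 2 P}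
    (hξ : ∀ i, ξ i ∈ gaussianSpace a P) (hon : Orthonormal ℝ ξ)
    (hF : ∀ᵐ ω ∂P, F ω = ∏ i, hermiteFun (p i) (ξ i ω)) :
    inner ℝ Z F = inner ℝ (lerayComponent ha hn hS (∑ i, p i)) F := by
  refine tendsto_nhds_unique (hZ.inner tendsto_const_nhds) ?_
  rw [inner_lerayComponent_of_prod ha hn hS p hξ hon hF]
  refine ((tendsto_integral_deltaApprox_mul_hermiteFun (∑ i, p i)).const_mul _).congr fun ε => ?_
  rw [inner_lerayLp]
  simp only [inner_deltaLp_of_prod p ha hn hS hξ hon hF, integral_mul_const]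

theorem chaosComponent_eq_lerayComponent (ha : IsGaussianCoefficients a P) (hn : 0 < n)
    (hS : n ∈ sumsOfTwoSquares) (hZ : Tendsto (lerayLp ha hn) (𝓝[>] 0) (𝓝 Z)) (q : ℕ) :
    chaosComponent a P q Z = lerayComponent ha hn hS q := by
  have hmem : lerayComponent ha hn hS q ∈ wienerChaos a P q :=
    Submodule.smul_mem _ _ (integral_hermiteLp_mem_wienerChaos ha hn hS q)
  have hle : wienerChaos a P q ≤ (Submodule.span ℝ {Z - lerayComponent ha hn hS q})ᗮ := by
    refine Submodule.topologicalClosure_minimal _ (Submodule.span_le.mpr ?_)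
      (Submodule.isClosed_orthogonal _)
    rintro F ⟨k, p, ξ, -, rfl, hξ, hlaw, hind, hF⟩
    rw [SetLike.mem_coe, Submodule.mem_orthogonal_singleton_iff_inner_right, inner_sub_left,
      sub_eq_zero]
    exact inner_eq_inner_lerayComponent_of_prod ha hn hS hZ p hξ
      (orthonormal_of_iIndepFun hlaw hind) hF
  exact Submodule.eq_starProjection_of_mem_of_inner_eq_zero hmem fun w hw =>
    Submodule.mem_orthogonal_singleton_iff_inner_right.mp (hle hw)

theorem integral_lerayComponent_succ (ha : IsGaussianCoefficients a P) (hn : 0 < n)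
    (hS : n ∈ sumsOfTwoSquares) (q : ℕ) : ∫ ω, lerayComponent ha hn hS (q + 1) ω ∂P = 0 := by
  rw [← inner_const_one, lerayComponent, real_inner_smul_left, inner_integral_hermiteLp]
  simp only [inner_const_one, integral_coeFn_hermiteLp_succ, integral_zero, mul_zero]

theorem variance_chaosComponent (ha : IsGaussianCoefficients a P) (hn : 0 < n)
    (hS : n ∈ sumsOfTwoSquares) (hZ : Tendsto (lerayLp ha hn) (𝓝[>] 0) (𝓝 Z)) {m : ℕ}
    (hm : m ≠ 0) : variance (chaosComponent a P (2 * m) Z) P =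
      (2 * Real.pi)⁻¹ * (centralCoeff m * ∫ x, waveCov n x ^ (2 * m)) := by
  obtain ⟨q, hq⟩ := Nat.exists_eq_succ_of_ne_zero (mul_ne_zero two_ne_zero hm)
  have hmean : ∫ ω, lerayComponent ha hn hS (2 * m) ω ∂P = 0 := by
    rw [hq]
    exact integral_lerayComponent_succ ha hn hS q
  have hfact : ((2 * m).factorial : ℝ) ≠ 0 := by exact_mod_cast Nat.factorial_ne_zero _
  rw [chaosComponent_eq_lerayComponent ha hn hS hZ, variance_eq_norm_sq_sub, hmean,
    lerayComponent, norm_smul, mul_pow, norm_sq_integral_hermiteLp, Real.norm_eq_abs, sq_abs,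
    div_pow, mul_pow, hermiteFun_two_mul_zero_sq, inv_pow, Real.sq_sqrt (by positivity)]
  field_simp
  ring

theorem variance_chaosComponent_two (ha : IsGaussianCoefficients a P) (hn : 0 < n)
    (hS : n ∈ sumsOfTwoSquares) (hZ : Tendsto (lerayLp ha hn) (𝓝[>] 0) (𝓝 Z)) :
    variance (chaosComponent a P 2 Z) P = 1 / (4 * Real.pi * latticeCount n) := by
  have h := variance_chaosComponent ha hn hS hZ one_ne_zero
  rw [mul_one, centralCoeff_one, integral_waveCov_sq] at h
  rw [h]
  field_simp
  norm_num

theorem summable_variance_chaosComponent (ha : IsGaussianCoefficients a P) (hn : 0 < n)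
    (hS : n ∈ sumsOfTwoSquares) (hZ : Tendsto (lerayLp ha hn) (𝓝[>] 0) (𝓝 Z)) {K : ℕ}
    (hK : K ≠ 0) : Summable fun j => variance (chaosComponent a P (2 * (K + j)) Z) P := by
  simp only [variance_chaosComponent ha hn hS hZ (m := K + _) (by lia)]
  exact (summable_centralCoeff_mul_integral hn K).mul_left _

theorem tsum_variance_chaosComponent_le (ha : IsGaussianCoefficients a P) (hn : 0 < n)
    (hS : n ∈ sumsOfTwoSquares) (hZ : Tendsto (lerayLp ha hn) (𝓝[>] 0) (𝓝 Z)) {K : ℕ}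
    (hK : K ≠ 0) : ∑' j, variance (chaosComponent a P (2 * (K + j)) Z) P ≤
      (2 * Real.pi)⁻¹ * (2 * (2 * K + 1)) * ∫ x, waveCov n x ^ (2 * K) := by
  simp only [variance_chaosComponent ha hn hS hZ (m := K + _) (by lia)]
  rw [tsum_mul_left, mul_assoc]
  gcongr
  exact tsum_centralCoeff_mul_integral_le hn K

theorem tsum_variance_chaosComponent_two_le (ha : IsGaussianCoefficients a P) (hn : 0 < n)
    (hS : n ∈ sumsOfTwoSquares) (hZ : Tendsto (lerayLp ha hn) (𝓝[>] 0) (𝓝 Z)) :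
    ∑' j, variance (chaosComponent a P (2 * (2 + j)) Z) P ≤
      (2 * Real.pi)⁻¹ * 30 / (latticeCount n : ℝ) ^ 2 :=
  calc ∑' j, variance (chaosComponent a P (2 * (2 + j)) Z) P
      ≤ (2 * Real.pi)⁻¹ * (2 * (2 * (2 : ℕ) + 1)) * ∫ x, waveCov n x ^ 4 :=
        tsum_variance_chaosComponent_le ha hn hS hZ two_ne_zero
    _ ≤ (2 * Real.pi)⁻¹ * (2 * (2 * (2 : ℕ) + 1)) * (3 / (latticeCount n : ℝ) ^ 2) := by
        gcongr
        exact integral_waveCov_pow_four_le n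
    _ = (2 * Real.pi)⁻¹ * 30 / (latticeCount n : ℝ) ^ 2 := by
        push_cast
        ring

theorem hasSum_variance_chaosComponent (ha : IsGaussianCoefficients a P) (hn : 0 < n)
    (hS : n ∈ sumsOfTwoSquares) (hZ : Tendsto (lerayLp ha hn) (𝓝[>] 0) (𝓝 Z)) :
    HasSum (fun j => variance (chaosComponent a P (2 * (j + 1)) Z) P) (variance Z P) := by
  have hvar : variance Z P = lerayMoment n - (2 * Real.pi)⁻¹ := by
    rw [variance_eq_norm_sq_sub, norm_sq_of_tendsto_lerayLp ha hn hS hZ,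
      integral_of_tendsto_lerayLp ha hn hS hZ, inv_pow, Real.sq_sqrt (by positivity)]
  have h := (hasSum_nat_add_iff' 1).mpr (hasSum_lerayMoment hn)
  simp only [variance_chaosComponent ha hn hS hZ (Nat.succ_ne_zero _), hvar]
  simpa [centralCoeff_zero] using h

theorem variance_sub_eq_tsum_variance_chaosComponent (ha : IsGaussianCoefficients a P)
    (hn : 0 < n) (hS : n ∈ sumsOfTwoSquares) (hZ : Tendsto (lerayLp ha hn) (𝓝[>] 0) (𝓝 Z)) :
    variance Z P - variance (chaosComponent a P 2 Z) P =
      ∑' j, variance (chaosComponent a P (2 * (2 + j)) Z) P := by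
  have h := hasSum_variance_chaosComponent ha hn hS hZ
  rw [← h.tsum_eq, h.summable.tsum_eq_zero_add, add_sub_cancel_left]
  exact tsum_congr fun j => by rw [add_assoc, add_comm 2 j]

end Limit

end Chaos

end ArithmeticWave

end

theorem proposition1 :
    -- the constants depend on nothing but `K`, where it occurs
    ∃ (C : ℕ → ℝ) (C₁ C₂ : ℝ),
      ∀ (Ω : Type*) [MeasurableSpace Ω] (P : Measure Ω) [IsProbabilityMeasure P]
        (a : (Fin 2 → ℤ) → Ω → ℂ), ArithmeticWave.IsGaussianCoefficients a P →
      ∀ n ∈ ArithmeticWave.sumsOfTwoSquares, 0 < n →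
      -- the Leray measure exists (it is almost surely unique) and is square integrable
      ∃ Z : Lp ℝ 2 P, ArithmeticWave.IsLerayMeasure a P n Z ∧
        -- the exact variance of the second chaotic component
        variance (ArithmeticWave.chaosComponent a P 2 Z) P
          = 1 / (4 * Real.pi * ArithmeticWave.latticeCount n) ∧
        -- the variance tails
        (∀ K : ℕ, 2 ≤ K →
          Summable (fun j : ℕ =>
            variance (ArithmeticWave.chaosComponent a P (2 * (K + j)) Z) P) ∧
          ∑' j : ℕ, variance (ArithmeticWave.chaosComponent a P (2 * (K + j)) Z) P
            ≤ C K * ∫ x : ArithmeticWave.Torus, ArithmeticWave.waveCov n x ^ (2 * K)) ∧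
        ∑' j : ℕ, variance (ArithmeticWave.chaosComponent a P (2 * (2 + j)) Z) P
          ≤ C₁ / (ArithmeticWave.latticeCount n : ℝ) ^ 2 ∧
        -- the variance asymptotics
        |variance Z P - 1 / (4 * Real.pi * ArithmeticWave.latticeCount n)|
          ≤ C₂ / (ArithmeticWave.latticeCount n : ℝ) ^ 2 := by
  open ArithmeticWave in
  refine ⟨fun K => (2 * Real.pi)⁻¹ * (2 * (2 * K + 1)), (2 * Real.pi)⁻¹ * 30,
    (2 * Real.pi)⁻¹ * 30, fun Ω _ P _ a ha n hS hn => ?_⟩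
  obtain ⟨Z, hZ⟩ := exists_tendsto_lerayLp ha hn hS
  have hsecond := variance_chaosComponent_two ha hn hS hZ
  have htail := tsum_variance_chaosComponent_two_le ha hn hS hZ
  refine ⟨Z, isLerayMeasure_of_tendsto ha hn hZ, hsecond, fun K hK => ?_, htail, ?_⟩
  · have hK0 : K ≠ 0 := Nat.ne_of_gt (zero_lt_two.trans_le hK)
    exact ⟨summable_variance_chaosComponent ha hn hS hZ hK0,
      tsum_variance_chaosComponent_le ha hn hS hZ hK0⟩
  · rw [← hsecond, variance_sub_eq_tsum_variance_chaosComponent ha hn hS hZ,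
      abs_of_nonneg (tsum_nonneg fun _ => variance_nonneg _ _)]
    exact htail
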